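/- For a real random variable $X$ with density $f$ with respect to Lebesgue measure let $h(X)=-\int_{\mathbb R} f\log f\,dx\in[-\infty,\infty]$ be its differential entropy, with $h(X)=-\infty$ when the integral does not exist or $X$ has no density. Let $I(X)=\int_{\mathbb R}\frac{(f'(x))^2}{f(x)}\,dx\in[0,\infty]$ be its Fisher information if $X$ has an absolutely continuous density $f$, and $I(X)=\infty$ otherwise. Let $X$ be a real random variable with $h(X)<\infty$ (the value $-\infty$ is allowed), for which there exists an independent random variable $Y$ such that $h(Y)$ and $h(X+Y)$ are both finite. Let $Z\sim\mathcal N(0,1)$ be independent of $X$. Then $h(X+\sqrt t\,Z)$ is finite for every $t>0$, and $$\frac{d}{dt}h(X+\sqrt t\,Z)\Big|_{t=0^+}:=\lim_{t\downarrow0}\frac{h(X+\sqrt t\,Z)-h(X)}{t}=\frac12 I(X),$$ where the limit is taken in $[-\infty,\infty]$ and the value $\infty$ is allowed. -/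

import Mathlib

open MeasureTheory ProbabilityTheory Filter Topology
open scoped ENNReal

noncomputable section

/-- Differential entropy `-∫ f log f` of a measure `μ` on `ℝ` with density `f`, as an extended real.
It is the integral of the positive part of `-f log f` minus the integral of the negative part.
It is `-∞` if `μ` has no density, and also if the integral does not exist, that is, if both parts
are infinite (in `EReal` one has `⊤ - ⊤ = ⊥`). -/
def differentialEntropyLaw (μ : Measure ℝ) : EReal :=
  open Classical in
  if μ ≪ volume then
    ((∫⁻ x, ENNReal.ofReal (Real.negMulLog (μ.rnDeriv volume x).toReal) : ℝ≥0∞) : EReal)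
      - ((∫⁻ x, ENNReal.ofReal (-Real.negMulLog (μ.rnDeriv volume x).toReal) : ℝ≥0∞) : EReal)
  else ⊥

/-- Differential entropy `h(X)` of a real random variable. -/
def differentialEntropy {Ω : Type*} [MeasurableSpace Ω] (X : Ω → ℝ) (P : Measure Ω) : EReal :=
  differentialEntropyLaw (P.map X)

/-- An extended real number is finite. -/
def EReal.Finite (a : EReal) : Prop := a ≠ ⊥ ∧ a ≠ ⊤

/-- `f` is an absolutely continuous density of `μ`: nonnegative, absolutely continuous on every
compact interval, and a density of `μ` with respect to Lebesgue measure. -/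
structure IsACDensity (μ : Measure ℝ) (f : ℝ → ℝ) : Prop where
  nonneg : ∀ x, 0 ≤ f x
  absCont : ∀ a b : ℝ, AbsolutelyContinuousOnInterval f a b
  eq_withDensity : μ = volume.withDensity (fun x => ENNReal.ofReal (f x))

/-- Fisher information `∫ (f')² / f` of a measure on `ℝ` with absolutely continuous density `f`.
Such an `f` is unique (`IsACDensity.unique`), so that the infimum has at most one term; it is `∞`
if there is no such `f`. A nonnegative `f` has derivative `0` wherever it vanishes and is
differentiable, so those points contribute nothing. -/
def fisherInfoLaw (μ : Measure ℝ) : ℝ≥0∞ :=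
  ⨅ (f : ℝ → ℝ) (_ : IsACDensity μ f), ∫⁻ x, ENNReal.ofReal ((deriv f x) ^ 2 / f x)

/-- Fisher information `I(X)` of a real random variable. -/
def fisherInfo {Ω : Type*} [MeasurableSpace Ω] (X : Ω → ℝ) (P : Measure Ω) : ℝ≥0∞ :=
  fisherInfoLaw (P.map X)

theorem IsACDensity.continuous {μ : Measure ℝ} {f : ℝ → ℝ} (hf : IsACDensity μ f) :
    Continuous f := by
  refine continuous_iff_continuousAt.2 fun x => ?_
  have h := (hf.absCont (x - 1) (x + 1)).continuousOn
  refine h.continuousAt ?_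
  rw [Set.uIcc_of_le (by linarith)]
  exact Icc_mem_nhds (by linarith) (by linarith)

theorem IsACDensity.unique {μ : Measure ℝ} [IsFiniteMeasure μ] {f g : ℝ → ℝ}
    (hf : IsACDensity μ f) (hg : IsACDensity μ g) : f = g := by
  have h1 : (fun x => ENNReal.ofReal (f x)) =ᵐ[volume] fun x => ENNReal.ofReal (g x) := by
    refine (withDensity_eq_iff hf.continuous.measurable.ennreal_ofReal.aemeasurable
      hg.continuous.measurable.ennreal_ofReal.aemeasurable ?_).1
      (hf.eq_withDensity.symm.trans hg.eq_withDensity)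
    rw [← setLIntegral_univ, ← withDensity_apply _ MeasurableSet.univ, ← hf.eq_withDensity]
    exact measure_ne_top _ _
  refine (Continuous.ae_eq_iff_eq volume hf.continuous hg.continuous).1 ?_
  filter_upwards [h1] with x hx
  exact (ENNReal.ofReal_eq_ofReal_iff (hf.nonneg x) (hg.nonneg x)).1 hx

theorem fisherInfoLaw_eq {μ : Measure ℝ} [IsFiniteMeasure μ] {f : ℝ → ℝ}
    (hf : IsACDensity μ f) :
    fisherInfoLaw μ = ∫⁻ x, ENNReal.ofReal ((deriv f x) ^ 2 / f x) := by
  refine le_antisymm (iInf₂_le f hf) (le_iInf₂ fun g hg => ?_)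
  rw [hf.unique hg]

end

/-! Let μ be the law of X, f_t = `heat μ t` the density of X + √t Z, h_t its entropy and J_t its
Fisher information. For t > 0 the density is smooth and solves the heat equation, so differentiating
under the integral and integrating by parts gives de Bruijn's identity h_t' = J_t / 2
(`hasDerivAt_heatEntropy`).

No moment of X is assumed, so the domination of log f_t comes from another source: for some r, the
function y ↦ log μ(B(y, r)) is μ-integrable. This is the only use of Y
(`exists_integrable_log_ballMass`). Since f_t(x) is at least μ(B(y, r)) times a Gaussian value at |x
- y| + r, for every y, this yields integrable bounds for |log f_t| against smoothed densities
(`exists_integrable_log_heat_bound`).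

To reach t = 0, write h_t - h_s = J_c (t - s) / 2 with s < c < t and let s tend to 0. For the lower
bound, h(X) ≤ h_s by concavity of -u log u (`integral_negMulLog_le_heatEntropy`), and J_c eventually
exceeds any number below I(X), because Fisher information is lower semicontinuous
(`fisherInfoLaw_le_of_heatFisher_le`, by weak compactness in L² of the derivatives of √f_t). For the
upper bound, when I(X) < ∞, smoothing does not increase Fisher information
(`IsACDensity.heatFisher_le`), and limsup h_s ≤ h(X) along sequences s → 0
(`eventually_heatEntropy_le`, by Fatou for relative entropy). If h(X) = -∞ the quotient is
constantly ∞, and so is I(X), as finite Fisher information forces a bounded density. -/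

/-! ### Entropy, integrals and convolutions of measures given by densities. -/

theorem differentialEntropyLaw_withDensity {q : ℝ → ℝ≥0∞} (hq : Measurable q) :
    differentialEntropyLaw (volume.withDensity q) =
      ((∫⁻ x, ENNReal.ofReal (Real.negMulLog (q x).toReal) : ℝ≥0∞) : EReal)
      - ((∫⁻ x, ENNReal.ofReal (-Real.negMulLog (q x).toReal) : ℝ≥0∞) : EReal) := by
  rw [differentialEntropyLaw, if_pos (withDensity_absolutelyContinuous _ _)]
  have h := Measure.rnDeriv_withDensity volume hq
  congr 2
  · exact lintegral_congr_ae (by filter_upwards [h] with x hx; rw [hx])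
  · exact lintegral_congr_ae (by filter_upwards [h] with x hx; rw [hx])

theorem differentialEntropyLaw_of_integrable {f : ℝ → ℝ} (hf : Measurable f) (h0 : ∀ x, 0 ≤ f x)
    (hint : Integrable fun x => Real.negMulLog (f x)) :
    differentialEntropyLaw (volume.withDensity fun x => ENNReal.ofReal (f x)) =
      ((∫ x, Real.negMulLog (f x) : ℝ) : EReal) := by
  rw [differentialEntropyLaw_withDensity hf.ennreal_ofReal]
  simp only [ENNReal.toReal_ofReal (h0 _)]
  rw [integral_eq_lintegral_pos_part_sub_lintegral_neg_part hint]
  have h1 := hint.lintegral_lt_top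
  have h2 := hint.neg.lintegral_lt_top
  simp only [Pi.neg_apply] at h2
  rw [EReal.coe_sub, EReal.coe_ennreal_toReal h1.ne, EReal.coe_ennreal_toReal h2.ne]

theorem integral_withDensity_ofReal {f : ℝ → ℝ} (hf : Measurable f) (h0 : ∀ x, 0 ≤ f x)
    (g : ℝ → ℝ) :
    ∫ x, g x ∂(volume.withDensity fun x => ENNReal.ofReal (f x)) = ∫ x, f x * g x := by
  rw [integral_withDensity_eq_integral_toReal_smul hf.ennreal_ofReal (by simp)]
  simp [ENNReal.toReal_ofReal (h0 _)]

theorem integrable_withDensity_ofReal_iff {f : ℝ → ℝ} (hf : Measurable f) (h0 : ∀ x, 0 ≤ f x)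
    {g : ℝ → ℝ} : Integrable g (volume.withDensity fun x => ENNReal.ofReal (f x)) ↔
      Integrable fun x => f x * g x := by
  rw [integrable_withDensity_iff_integrable_smul' hf.ennreal_ofReal (by simp)]
  simp [ENNReal.toReal_ofReal (h0 _)]

theorem conv_withDensity (μ : Measure ℝ) [SFinite μ] {q : ℝ → ℝ≥0∞} (hq : Measurable q) :
    μ ∗ (volume.withDensity q) = volume.withDensity fun w => ∫⁻ x, q (w - x) ∂μ := by
  refine Measure.ext_of_lintegral _ fun φ hφ => ?_
  have hm : Measurable fun w => ∫⁻ x, q (w - x) ∂μ := by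
    refine Measurable.lintegral_prod_right' (f := fun p : ℝ × ℝ => q (p.1 - p.2)) ?_
    fun_prop
  rw [Measure.lintegral_conv hφ, lintegral_withDensity_eq_lintegral_mul _ hm hφ]
  have h1 : ∀ x, ∫⁻ y, φ (x + y) ∂(volume.withDensity q) = ∫⁻ w, q (w - x) * φ w := by
    intro x
    rw [lintegral_withDensity_eq_lintegral_mul _ hq (by fun_prop),
      ← lintegral_sub_right_eq_self _ x]
    simp
  simp_rw [h1, Pi.mul_apply]
  rw [lintegral_lintegral_swap]
  · refine lintegral_congr fun w => ?_
    rw [lintegral_mul_const _ (by fun_prop)]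
  · refine Measurable.aemeasurable ?_
    simp only [Function.uncurry_def]
    fun_prop

/-! ### The heat kernel and its derivatives, with bounds uniform for t in [a, b]. -/

/-- The Gaussian heat kernel. -/
noncomputable def heatKernel (t x : ℝ) : ℝ := (√(2 * Real.pi * t))⁻¹ * Real.exp (-x ^ 2 / (2 * t))

/-- First space derivative of the heat kernel. -/
noncomputable def heatKernelDeriv (t x : ℝ) : ℝ := -(x / t) * heatKernel t x

/-- Second space derivative of the heat kernel. -/
noncomputable def heatKernelDeriv2 (t x : ℝ) : ℝ := (x ^ 2 / t ^ 2 - 1 / t) * heatKernel t x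

/-- A function dominating the heat kernel and its derivatives. -/
noncomputable def heatBound (b x : ℝ) : ℝ := (1 + x ^ 2) * Real.exp (-x ^ 2 / (2 * b))

theorem heatKernel_pos {t : ℝ} (ht : 0 < t) (x : ℝ) : 0 < heatKernel t x := by
  unfold heatKernel; positivity

@[fun_prop]
theorem continuous_heatKernel (t : ℝ) : Continuous (heatKernel t) := by
  unfold heatKernel; fun_prop

@[fun_prop]
theorem continuous_heatKernelDeriv (t : ℝ) : Continuous (heatKernelDeriv t) := by
  unfold heatKernelDeriv; fun_prop

@[fun_prop]
theorem continuous_heatKernelDeriv2 (t : ℝ) : Continuous (heatKernelDeriv2 t) := by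
  unfold heatKernelDeriv2; fun_prop

@[fun_prop]
theorem continuous_heatBound (b : ℝ) : Continuous (heatBound b) := by
  unfold heatBound; fun_prop

theorem hasDerivAt_heatKernel {t : ℝ} (ht : 0 < t) (x : ℝ) :
    HasDerivAt (heatKernel t) (heatKernelDeriv t x) x := by
  have h := ((((hasDerivAt_id x).pow 2).neg.div_const (2 * t)).exp).const_mul
    ((√(2 * Real.pi * t))⁻¹)
  refine h.congr_deriv ?_
  simp only [heatKernelDeriv, heatKernel, Pi.neg_apply, Pi.pow_apply, id]
  field_simp
  norm_num

theorem hasDerivAt_heatKernelDeriv {t : ℝ} (ht : 0 < t) (x : ℝ) :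
    HasDerivAt (heatKernelDeriv t) (heatKernelDeriv2 t x) x := by
  have h := (((hasDerivAt_id x).div_const t).neg).mul (hasDerivAt_heatKernel ht x)
  refine h.congr_deriv ?_
  simp only [heatKernelDeriv2, heatKernelDeriv, Pi.neg_apply, id]
  field_simp
  ring

theorem hasDerivAt_heatKernel_time {t : ℝ} (ht : 0 < t) (x : ℝ) :
    HasDerivAt (fun s => heatKernel s x) (2⁻¹ * heatKernelDeriv2 t x) t := by
  have hpos : 0 < 2 * Real.pi * t := by positivity
  have h1 : HasDerivAt (fun s => (√(2 * Real.pi * s))⁻¹)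
      (-(1 / (2 * √(2 * Real.pi * t)) * (2 * Real.pi * 1)) / (√(2 * Real.pi * t)) ^ 2) t :=
    (((Real.hasDerivAt_sqrt hpos.ne').comp t ((hasDerivAt_id t).const_mul _))).inv
      (Real.sqrt_pos.2 hpos).ne'
  have h2 : HasDerivAt (fun s : ℝ => Real.exp (-x ^ 2 / (2 * s)))
      (Real.exp (-x ^ 2 / (2 * t)) * ((0 * (2 * t) - -x ^ 2 * (2 * 1)) / (2 * t) ^ 2)) t :=
    ((hasDerivAt_const t (-x ^ 2)).div ((hasDerivAt_id t).const_mul 2)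
      (by simp only [id]; positivity)).exp
  refine (h1.mul h2).congr_deriv ?_
  simp only [heatKernelDeriv2, heatKernel]
  rw [Real.sq_sqrt hpos.le]
  have : 0 < √(2 * Real.pi * t) := by positivity
  field_simp
  ring

theorem heatBound_le {b : ℝ} (hb : 0 < b) (x : ℝ) : heatBound b x ≤ 1 + 2 * b := by
  have h1 : x ^ 2 / (2 * b) + 1 ≤ Real.exp (x ^ 2 / (2 * b)) := Real.add_one_le_exp _
  have h2 : 0 ≤ x ^ 2 / (2 * b) := by positivity
  have h3 : Real.exp (-x ^ 2 / (2 * b)) = (Real.exp (x ^ 2 / (2 * b)))⁻¹ := by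
    rw [neg_div, Real.exp_neg]
  rw [heatBound, h3, ← div_eq_mul_inv, div_le_iff₀ (by positivity)]
  have h4 : x ^ 2 = (x ^ 2 / (2 * b)) * (2 * b) := by field_simp
  nlinarith

theorem heatBound_pos (b x : ℝ) : 0 < heatBound b x := by unfold heatBound; positivity

/-- The constant in the bound of the heat kernel and its derivatives by `heatBound`. -/
noncomputable def heatConst (a : ℝ) : ℝ := (√(2 * Real.pi * a))⁻¹ * (1 + 1 / a + 1 / a ^ 2)

theorem heatConst_pos {a : ℝ} (ha : 0 < a) : 0 < heatConst a := by unfold heatConst; positivity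

theorem heatKernel_le_exp {a b t : ℝ} (ha : 0 < a) (hat : a ≤ t) (htb : t ≤ b) (x : ℝ) :
    heatKernel t x ≤ (√(2 * Real.pi * a))⁻¹ * Real.exp (-x ^ 2 / (2 * b)) := by
  have ht : 0 < t := ha.trans_le hat
  have hb : 0 < b := ht.trans_le htb
  unfold heatKernel
  have h : -x ^ 2 / (2 * t) ≤ -x ^ 2 / (2 * b) := by
    rw [neg_div, neg_div, neg_le_neg_iff]
    gcongr
  gcongr

theorem heatKernel_le {t : ℝ} (ht : 0 < t) (x : ℝ) :
    heatKernel t x ≤ (√(2 * Real.pi * t))⁻¹ := by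
  refine (heatKernel_le_exp ht le_rfl le_rfl x).trans ?_
  refine mul_le_of_le_one_right (by positivity) (Real.exp_le_one_iff.2 ?_)
  rw [neg_div]; simp; positivity

/-- For t in [a, b] the normalizing factor is largest at t = a and the exponential at t = b. The
polynomial c stands for the factors produced by differentiating the kernel. -/
theorem mul_heatKernel_le {a b t c : ℝ} (ha : 0 < a) (hat : a ≤ t) (htb : t ≤ b) (x : ℝ)
    (hc : c ≤ (1 + 1 / a + 1 / a ^ 2) * (1 + x ^ 2)) :
    c * heatKernel t x ≤ heatConst a * heatBound b x := by
  calc c * heatKernel t x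
      ≤ ((1 + 1 / a + 1 / a ^ 2) * (1 + x ^ 2)) *
        ((√(2 * Real.pi * a))⁻¹ * Real.exp (-x ^ 2 / (2 * b))) := by
        gcongr
        · exact (heatKernel_pos (ha.trans_le hat) x).le
        · exact heatKernel_le_exp ha hat htb x
    _ = _ := by unfold heatConst heatBound; ring

theorem heatKernel_le_heatBound {a b t : ℝ} (ha : 0 < a) (hat : a ≤ t) (htb : t ≤ b) (x : ℝ) :
    heatKernel t x ≤ heatConst a * heatBound b x := by
  rw [← one_mul (heatKernel t x)]
  refine mul_heatKernel_le ha hat htb x ?_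
  have h1 : 0 ≤ 1 / a + 1 / a ^ 2 := by positivity
  nlinarith [sq_nonneg x, mul_nonneg h1 (sq_nonneg x)]

theorem abs_heatKernelDeriv_le {a b t : ℝ} (ha : 0 < a) (hat : a ≤ t) (htb : t ≤ b) (x : ℝ) :
    |heatKernelDeriv t x| ≤ heatConst a * heatBound b x := by
  have ht := ha.trans_le hat
  rw [heatKernelDeriv, abs_mul, abs_of_pos (heatKernel_pos ht x)]
  refine mul_heatKernel_le ha hat htb x ?_
  rw [abs_neg, abs_div, abs_of_pos ht]
  calc |x| / t ≤ |x| / a := by gcongr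
    _ = (1 / a) * |x| := by ring
    _ ≤ (1 + 1 / a + 1 / a ^ 2) * (1 + x ^ 2) := by
      gcongr
      · have : 0 ≤ 1 / a ^ 2 := by positivity
        linarith
      · nlinarith [sq_abs x, sq_nonneg (|x| - 1)]

theorem sq_mul_heatKernel_le {a b t : ℝ} (ha : 0 < a) (hat : a ≤ t) (htb : t ≤ b) (x : ℝ) :
    (x / t) ^ 2 * heatKernel t x ≤ heatConst a * heatBound b x := by
  have ht := ha.trans_le hat
  refine mul_heatKernel_le ha hat htb x ?_
  calc (x / t) ^ 2 = x ^ 2 / t ^ 2 := by rw [div_pow]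
    _ ≤ x ^ 2 / a ^ 2 := by gcongr
    _ = (1 / a ^ 2) * x ^ 2 := by ring
    _ ≤ _ := by
      gcongr
      · have : 0 ≤ 1 / a := by positivity
        linarith
      · linarith

theorem abs_heatKernelDeriv2_le {a b t : ℝ} (ha : 0 < a) (hat : a ≤ t) (htb : t ≤ b) (x : ℝ) :
    |heatKernelDeriv2 t x| ≤ heatConst a * heatBound b x := by
  have ht := ha.trans_le hat
  rw [heatKernelDeriv2, abs_mul, abs_of_pos (heatKernel_pos ht x)]
  refine mul_heatKernel_le ha hat htb x ?_
  calc |x ^ 2 / t ^ 2 - 1 / t| ≤ |x ^ 2 / t ^ 2| + |1 / t| := abs_sub _ _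
    _ = x ^ 2 / t ^ 2 + 1 / t := by
      rw [abs_of_nonneg (by positivity), abs_of_nonneg (by positivity)]
    _ ≤ x ^ 2 / a ^ 2 + 1 / a := by gcongr
    _ ≤ _ := by
      have h1 : 0 ≤ 1 / a := by positivity
      have h2 : 0 ≤ 1 / a ^ 2 := by positivity
      have h3 : x ^ 2 / a ^ 2 = (1 / a ^ 2) * x ^ 2 := by ring
      rw [h3]
      nlinarith [sq_nonneg x, mul_nonneg h1 (sq_nonneg x)]

theorem integrable_pow_mul_exp {b : ℝ} (hb : 0 < b) (n : ℕ) :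
    Integrable fun x : ℝ => x ^ n * Real.exp (-x ^ 2 / (2 * b)) := by
  have h := integrable_rpow_mul_exp_neg_mul_sq (b := (2 * b)⁻¹) (by positivity) (s := n)
    (by have : (0 : ℝ) ≤ n := n.cast_nonneg
        linarith)
  refine h.congr (Eventually.of_forall fun x => ?_)
  simp only [Real.rpow_natCast]
  congr 2
  field_simp

theorem integrable_heatBound {b : ℝ} (hb : 0 < b) : Integrable (heatBound b) := by
  refine ((integrable_pow_mul_exp hb 0).add (integrable_pow_mul_exp hb 2)).congr
    (Eventually.of_forall fun x => ?_)
  simp only [heatBound, Pi.add_apply]; ring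

theorem integrable_heatBound_mul {b : ℝ} (hb : 0 < b) :
    Integrable fun x => heatBound b x * (1 + x ^ 2) := by
  refine ((integrable_pow_mul_exp hb 0).add (((integrable_pow_mul_exp hb 2).const_mul 2).add
    (integrable_pow_mul_exp hb 4))).congr (Eventually.of_forall fun x => ?_)
  simp only [heatBound, Pi.add_apply]; ring

theorem heatKernel_eq_gaussianPDFReal {t : ℝ} (ht : 0 < t) :
    heatKernel t = gaussianPDFReal 0 t.toNNReal := by
  funext x
  simp [heatKernel, gaussianPDFReal, ht.le]

theorem integrable_heatKernel {t : ℝ} (ht : 0 < t) : Integrable (heatKernel t) := by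
  rw [heatKernel_eq_gaussianPDFReal ht]
  exact integrable_gaussianPDFReal _ _

theorem integral_heatKernel {t : ℝ} (ht : 0 < t) : ∫ x, heatKernel t x = 1 := by
  rw [heatKernel_eq_gaussianPDFReal ht]
  exact integral_gaussianPDFReal_eq_one _ (Real.toNNReal_pos.2 ht).ne'

theorem gaussianReal_eq_withDensity_heatKernel {t : ℝ} (ht : 0 < t) :
    gaussianReal 0 t.toNNReal = volume.withDensity fun x => ENNReal.ofReal (heatKernel t x) := by
  rw [gaussianReal_of_var_ne_zero _ (Real.toNNReal_pos.2 ht).ne', heatKernel_eq_gaussianPDFReal ht]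
  rfl

/-! ### The smoothed density, its derivatives and the heat equation. -/

/-- The density of the convolution of `μ` with the centered Gaussian of variance `t`. -/
noncomputable def heat (μ : Measure ℝ) (t x : ℝ) : ℝ := ∫ y, heatKernel t (x - y) ∂μ

/-- The first space derivative of `heat`. -/
noncomputable def heatDeriv (μ : Measure ℝ) (t x : ℝ) : ℝ := ∫ y, heatKernelDeriv t (x - y) ∂μ

/-- The second space derivative of `heat`. -/
noncomputable def heatDeriv2 (μ : Measure ℝ) (t x : ℝ) : ℝ := ∫ y, heatKernelDeriv2 t (x - y) ∂μ

/-- The convolution of `heatBound` with `μ`. -/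
noncomputable def heatMajorant (μ : Measure ℝ) (b x : ℝ) : ℝ := ∫ y, heatBound b (x - y) ∂μ

/-- The mass that `μ` gives to the closed ball of radius `r` around `y`. -/
noncomputable def ballMass (μ : Measure ℝ) (r y : ℝ) : ℝ := μ.real (Metric.closedBall y r)

theorem integrable_conv_kernel (μ : Measure ℝ) [IsFiniteMeasure μ] {k g : ℝ → ℝ} (hk : Integrable k)
    (hg : Integrable g μ) :
    Integrable (fun p : ℝ × ℝ => k (p.1 - p.2) * g p.2) (volume.prod μ) := by
  refine (hg.convolution_integrand (ContinuousLinearMap.mul ℝ ℝ) hk).congr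
    (Eventually.of_forall fun p => ?_)
  simp [mul_comm]

theorem heat_nonneg (μ : Measure ℝ) {t : ℝ} (ht : 0 < t) (x : ℝ) : 0 ≤ heat μ t x :=
  integral_nonneg fun _ => (heatKernel_pos ht _).le

section Finite

variable (μ : Measure ℝ) [IsFiniteMeasure μ]

theorem integrable_translate {k : ℝ → ℝ} (hk : Continuous k) {M : ℝ} (hM : ∀ x, |k x| ≤ M) (x : ℝ) :
    Integrable (fun y => k (x - y)) μ :=
  Integrable.of_bound (by fun_prop) M (Eventually.of_forall fun _ => hM _)

theorem heatBound_abs_le {b : ℝ} (hb : 0 < b) (x : ℝ) : |heatBound b x| ≤ 1 + 2 * b := by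
  rw [abs_of_pos (heatBound_pos b x)]; exact heatBound_le hb x

theorem integrable_heatBound_translate {b : ℝ} (hb : 0 < b) (x : ℝ) :
    Integrable (fun y => heatBound b (x - y)) μ :=
  integrable_translate μ (by fun_prop) (heatBound_abs_le hb) x

theorem integrable_of_le_heatBound {k : ℝ → ℝ} (hk : Continuous k) {K b : ℝ} (hb : 0 < b)
    (h : ∀ x, |k x| ≤ K * heatBound b x) (x : ℝ) : Integrable (fun y => k (x - y)) μ :=
  ((integrable_heatBound_translate μ hb x).const_mul K).mono' (by fun_prop)
    (Eventually.of_forall fun _ => h _)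

theorem abs_heatKernel_le {a b t : ℝ} (ha : 0 < a) (hat : a ≤ t) (htb : t ≤ b) (x : ℝ) :
    |heatKernel t x| ≤ heatConst a * heatBound b x := by
  rw [abs_of_pos (heatKernel_pos (ha.trans_le hat) x)]
  exact heatKernel_le_heatBound ha hat htb x

theorem integrable_heatKernel_translate {t : ℝ} (ht : 0 < t) (x : ℝ) :
    Integrable (fun y => heatKernel t (x - y)) μ :=
  integrable_of_le_heatBound μ (by fun_prop) ht (abs_heatKernel_le ht le_rfl le_rfl) x

theorem integrable_heatKernelDeriv_translate {t : ℝ} (ht : 0 < t) (x : ℝ) :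
    Integrable (fun y => heatKernelDeriv t (x - y)) μ :=
  integrable_of_le_heatBound μ (by fun_prop) ht (abs_heatKernelDeriv_le ht le_rfl le_rfl) x

theorem abs_integral_le_heatMajorant {k : ℝ → ℝ} {K b : ℝ} (hb : 0 < b)
    (h : ∀ x, |k x| ≤ K * heatBound b x) (x : ℝ) :
    |∫ y, k (x - y) ∂μ| ≤ K * heatMajorant μ b x := by
  rw [heatMajorant, ← integral_const_mul]
  exact norm_integral_le_of_norm_le (f := fun y => k (x - y))
    ((integrable_heatBound_translate μ hb x).const_mul K)
    (Eventually.of_forall fun y => h (x - y))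

theorem hasDerivAt_integral_translate {k k' : ℝ → ℝ} (hk : ∀ x, HasDerivAt k (k' x) x)
    (hk' : Continuous k') {K b : ℝ} (hb : 0 < b) (h : ∀ x, |k x| ≤ K * heatBound b x)
    (h' : ∀ x, |k' x| ≤ K * heatBound b x) (hK : 0 ≤ K) (x : ℝ) :
    HasDerivAt (fun x => ∫ y, k (x - y) ∂μ) (∫ y, k' (x - y) ∂μ) x := by
  have hkc : Continuous k := continuous_iff_continuousAt.2 fun x => (hk x).continuousAt
  refine (hasDerivAt_integral_of_dominated_loc_of_deriv_le (s := Set.univ) univ_mem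
    (F := fun x y => k (x - y)) (F' := fun x y => k' (x - y)) (bound := fun _ => K * (1 + 2 * b))
    (Eventually.of_forall fun x => ?_) (integrable_of_le_heatBound μ hkc hb h x) ?_ ?_
    (integrable_const _) ?_).2
  · exact (hkc.comp (by fun_prop)).aestronglyMeasurable
  · exact (hk'.comp (by fun_prop)).aestronglyMeasurable
  · refine Eventually.of_forall fun y x _ => (h' _).trans ?_
    gcongr
    exact heatBound_le hb _
  · exact Eventually.of_forall fun y x _ => (hk (x - y)).comp_sub_const x y

theorem hasDerivAt_heat {t : ℝ} (ht : 0 < t) (x : ℝ) :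
    HasDerivAt (heat μ t) (heatDeriv μ t x) x :=
  hasDerivAt_integral_translate μ (hasDerivAt_heatKernel ht) (by fun_prop) ht
    (abs_heatKernel_le ht le_rfl le_rfl) (abs_heatKernelDeriv_le ht le_rfl le_rfl)
    (heatConst_pos ht).le x

theorem hasDerivAt_heatDeriv {t : ℝ} (ht : 0 < t) (x : ℝ) :
    HasDerivAt (heatDeriv μ t) (heatDeriv2 μ t x) x :=
  hasDerivAt_integral_translate μ (hasDerivAt_heatKernelDeriv ht) (by fun_prop) ht
    (abs_heatKernelDeriv_le ht le_rfl le_rfl) (abs_heatKernelDeriv2_le ht le_rfl le_rfl)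
    (heatConst_pos ht).le x

theorem hasDerivAt_heat_time {t : ℝ} (ht : 0 < t) (x : ℝ) :
    HasDerivAt (fun s => heat μ s x) (2⁻¹ * heatDeriv2 μ t x) t := by
  have h2 : 0 < t / 2 := by positivity
  rw [heatDeriv2, ← integral_const_mul]
  refine (hasDerivAt_integral_of_dominated_loc_of_deriv_le (s := Set.Ioo (t / 2) (2 * t))
    (F := fun s y => heatKernel s (x - y)) (F' := fun s y => 2⁻¹ * heatKernelDeriv2 s (x - y))
    (bound := fun y => heatConst (t / 2) * heatBound (2 * t) (x - y))
    (Ioo_mem_nhds (by linarith) (by linarith)) (Eventually.of_forall fun s => ?_)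
    (integrable_heatKernel_translate μ ht x) ?_ ?_
    ((integrable_heatBound_translate μ (by positivity) x).const_mul _) ?_).2
  · exact ((continuous_heatKernel s).comp (by fun_prop)).aestronglyMeasurable
  · exact (((continuous_heatKernelDeriv2 t).comp (by fun_prop)).const_mul _).aestronglyMeasurable
  · refine Eventually.of_forall fun y s hs => ?_
    have h := abs_heatKernelDeriv2_le h2 hs.1.le hs.2.le (x - y)
    rw [Real.norm_eq_abs, abs_mul, abs_of_pos (by norm_num : (0 : ℝ) < 2⁻¹)]
    linarith [abs_nonneg (heatKernelDeriv2 s (x - y))]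
  · exact Eventually.of_forall fun y s hs => hasDerivAt_heatKernel_time (h2.trans hs.1) _

@[fun_prop]
theorem measurable_heat (t : ℝ) : Measurable (heat μ t) := by
  refine (StronglyMeasurable.integral_prod_right' (f := fun p : ℝ × ℝ => heatKernel t (p.1 - p.2))
    ?_).measurable
  exact (by fun_prop : Continuous _).stronglyMeasurable

theorem continuous_heat {t : ℝ} (ht : 0 < t) : Continuous (heat μ t) :=
  continuous_iff_continuousAt.2 fun x => (hasDerivAt_heat μ ht x).continuousAt

theorem continuous_heatDeriv {t : ℝ} (ht : 0 < t) : Continuous (heatDeriv μ t) :=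
  continuous_iff_continuousAt.2 fun x => (hasDerivAt_heatDeriv μ ht x).continuousAt

@[fun_prop]
theorem measurable_heatDeriv2 (t : ℝ) : Measurable (heatDeriv2 μ t) := by
  refine (StronglyMeasurable.integral_prod_right'
    (f := fun p : ℝ × ℝ => heatKernelDeriv2 t (p.1 - p.2)) ?_).measurable
  exact (by fun_prop : Continuous _).stronglyMeasurable

/-! ### Bounds for the logarithm of the smoothed density by masses of balls. -/

/-- Keep only the part of the convolution over the ball around y: there |x - z| ≤ |x - y| + r, and
the kernel decreases in the distance. -/
theorem ballMass_mul_heatKernel_le {t r : ℝ} (ht : 0 < t) (x y : ℝ) :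
    ballMass μ r y * heatKernel t (|x - y| + r) ≤ heat μ t x := by
  calc ballMass μ r y * heatKernel t (|x - y| + r)
      = ∫ _ in Metric.closedBall y r, heatKernel t (|x - y| + r) ∂μ := by
        simp [ballMass]
    _ ≤ ∫ z in Metric.closedBall y r, heatKernel t (x - z) ∂μ := by
        refine setIntegral_mono_on (integrable_const _)
          (integrable_heatKernel_translate μ ht x).integrableOn
          Metric.isClosed_closedBall.measurableSet fun z hz => ?_
        have hz' : |z - y| ≤ r := by simpa [Real.dist_eq] using hz
        have h1 : |x - z| ≤ |x - y| + r := by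
          have : x - z = (x - y) - (z - y) := by ring
          rw [this]
          exact (abs_sub _ _).trans (by linarith)
        unfold heatKernel
        have h2 : -(|x - y| + r) ^ 2 / (2 * t) ≤ -(x - z) ^ 2 / (2 * t) := by
          rw [← sq_abs (x - z)]
          gcongr
        gcongr
    _ ≤ heat μ t x := setIntegral_le_integral (integrable_heatKernel_translate μ ht x)
        (Eventually.of_forall fun _ => (heatKernel_pos ht _).le)

theorem measurable_ballMass (r : ℝ) : Measurable (ballMass μ r) := by
  have h : MeasurableSet {p : ℝ × ℝ | dist p.2 p.1 ≤ r} :=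
    (isClosed_le (by fun_prop) continuous_const).measurableSet
  exact (measurable_measure_prodMk_left h).ennreal_toReal

theorem ballMass_pos_ae {r : ℝ} (hr : 0 < r) : ∀ᵐ y ∂μ, 0 < ballMass μ r y := by
  filter_upwards [μ.support_mem_ae] with y hy
  have := (Measure.mem_support_iff_forall y).1 hy _ (Metric.closedBall_mem_nhds y hr)
  exact ENNReal.toReal_pos this.ne' (measure_ne_top _ _)

end Finite

section Prob

variable (μ : Measure ℝ) [IsProbabilityMeasure μ]

theorem ballMass_le_one (r y : ℝ) : ballMass μ r y ≤ 1 := measureReal_le_one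

theorem heat_le {t : ℝ} (ht : 0 < t) (x : ℝ) : heat μ t x ≤ (√(2 * Real.pi * t))⁻¹ := by
  calc heat μ t x ≤ ∫ _, (√(2 * Real.pi * t))⁻¹ ∂μ :=
        integral_mono (integrable_heatKernel_translate μ ht x) (integrable_const _)
          fun _ => heatKernel_le ht _
    _ = _ := by simp

theorem heat_pos {t : ℝ} (ht : 0 < t) (x : ℝ) : 0 < heat μ t x := by
  obtain ⟨y, hy⟩ := (ballMass_pos_ae μ one_pos).exists
  exact (mul_pos hy (heatKernel_pos ht _)).trans_le (ballMass_mul_heatKernel_le μ ht x y)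

theorem integrable_heat {t : ℝ} (ht : 0 < t) : Integrable (heat μ t) := by
  have := (integrable_conv_kernel μ (integrable_heatKernel ht)
    (integrable_const (1 : ℝ))).integral_prod_left
  simp only [mul_one] at this
  exact this

theorem conv_gaussianReal {t : ℝ} (ht : 0 < t) :
    μ ∗ gaussianReal 0 t.toNNReal = volume.withDensity fun x => ENNReal.ofReal (heat μ t x) := by
  rw [gaussianReal_eq_withDensity_heatKernel ht,
    conv_withDensity μ (continuous_heatKernel t).measurable.ennreal_ofReal]
  congr 1
  funext x
  rw [heat, ofReal_integral_eq_lintegral_ofReal (integrable_heatKernel_translate μ ht x)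
    (Eventually.of_forall fun _ => (heatKernel_pos ht _).le)]

theorem integral_heat {t : ℝ} (ht : 0 < t) : ∫ x, heat μ t x = 1 := by
  have h : IsProbabilityMeasure (μ ∗ gaussianReal 0 t.toNNReal) := inferInstance
  rw [conv_gaussianReal μ ht] at h
  have h1 := h.measure_univ
  rw [withDensity_apply _ MeasurableSet.univ, setLIntegral_univ] at h1
  rw [integral_eq_lintegral_of_nonneg_ae (Eventually.of_forall fun x => heat_nonneg μ ht x)
    (by fun_prop), h1, ENNReal.toReal_one]

theorem exists_abs_log_heat_le {a b r : ℝ} (ha : 0 < a) :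
    ∃ C : ℝ, 0 ≤ C ∧ ∀ t, a ≤ t → t ≤ b → ∀ x y, 0 < ballMass μ r y →
      |Real.log (heat μ t x)| ≤ -Real.log (ballMass μ r y) + C * (1 + (x - y) ^ 2) := by
  -- The two logarithms control the normalizing factor for t in [a, b]; the other terms come from
  -- (|x - y| + r)² ≤ 2((x - y)² + r²) divided by 2t ≥ 2a.
  set C := |Real.log √(2 * Real.pi * a)| + |Real.log √(2 * Real.pi * b)| + 1 / a + r ^ 2 / a with hC
  have hCa : 0 ≤ 1 / a := by positivity
  have hCr : 0 ≤ r ^ 2 / a := by positivity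
  have hA := abs_nonneg (Real.log √(2 * Real.pi * a))
  have hB := abs_nonneg (Real.log √(2 * Real.pi * b))
  have hC0 : 0 ≤ C := by positivity
  refine ⟨C, hC0, fun t hat htb x y hy => ?_⟩
  have ht := ha.trans_le hat
  have hm : 0 ≤ -Real.log (ballMass μ r y) := by
    have := Real.log_nonpos hy.le (ballMass_le_one μ r y)
    linarith
  have hx2 : 0 ≤ C * (x - y) ^ 2 := by positivity
  rw [abs_le]
  constructor
  · have h1 := Real.log_le_log (mul_pos hy (heatKernel_pos ht _))
      (ballMass_mul_heatKernel_le μ ht x y)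
    rw [Real.log_mul hy.ne' (heatKernel_pos ht _).ne', heatKernel,
      Real.log_mul (by positivity) (Real.exp_pos _).ne', Real.log_exp, Real.log_inv] at h1
    have h2 : Real.log √(2 * Real.pi * t) ≤ Real.log √(2 * Real.pi * b) := by gcongr
    have h3 : (|x - y| + r) ^ 2 / (2 * t) ≤ (x - y) ^ 2 / a + r ^ 2 / a := by
      rw [← add_div, div_le_div_iff₀ (by positivity) ha]
      have h4 : (|x - y| + r) ^ 2 ≤ 2 * ((x - y) ^ 2 + r ^ 2) := by
        rw [← sq_abs (x - y)]
        nlinarith [sq_nonneg (|x - y| - r)]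
      calc (|x - y| + r) ^ 2 * a ≤ 2 * ((x - y) ^ 2 + r ^ 2) * t := by gcongr
        _ = _ := by ring
    rw [neg_div] at h1
    have h5 : (x - y) ^ 2 / a = (1 / a) * (x - y) ^ 2 := by ring
    have h6 : (1 / a) * (x - y) ^ 2 ≤ C * (x - y) ^ 2 := by
      gcongr
      rw [hC]; linarith
    have := le_abs_self (Real.log √(2 * Real.pi * b))
    nlinarith
  · have h1 := Real.log_le_log (heat_pos μ ht x) (heat_le μ ht x)
    rw [Real.log_inv] at h1
    have h2 : Real.log √(2 * Real.pi * a) ≤ Real.log √(2 * Real.pi * t) := by gcongr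
    have := neg_abs_le (Real.log √(2 * Real.pi * a))
    nlinarith

/-- The bound on |log f_t(x)| holds for almost every y, so it can be placed inside the integral over
y that defines `heatMajorant`. The result is a convolution-type integral, integrable in x by Fubini,
and it does not depend on t. -/
theorem exists_integrable_log_heat_bound {a b r : ℝ} (ha : 0 < a) (hab : a ≤ b) (hr : 0 < r)
    (hμ : Integrable (fun y => Real.log (ballMass μ r y)) μ) :
    ∃ E : ℝ → ℝ, Integrable E ∧ ∀ᵐ x, ∀ t, a ≤ t → t ≤ b →
      (|Real.log (heat μ t x)| + 1) * heatMajorant μ b x ≤ E x := by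
  obtain ⟨C, hC, h⟩ := exists_abs_log_heat_le μ (a := a) (b := b) (r := r) ha
  have hb := ha.trans_le hab
  have h1 := integrable_conv_kernel μ (integrable_heatBound hb)
    (hμ.neg.add (integrable_const (1 : ℝ)))
  have h2 := integrable_conv_kernel μ (integrable_heatBound_mul hb) (integrable_const C)
  have h3 := h1.add h2
  refine ⟨_, h3.integral_prod_left, ?_⟩
  filter_upwards [h3.prod_right_ae] with x hx t hat htb
  rw [heatMajorant, ← integral_const_mul]
  refine integral_mono_ae ((integrable_heatBound_translate μ hb x).const_mul _) hx ?_
  filter_upwards [ballMass_pos_ae μ hr] with y hy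
  have h4 := h t hat htb x y hy
  have h5 := (heatBound_pos b (x - y)).le
  simp only [Pi.add_apply, Pi.neg_apply]
  calc _ ≤ (-Real.log (ballMass μ r y) + C * (1 + (x - y) ^ 2) + 1) * heatBound b (x - y) := by
        gcongr
    _ = _ := by ring

end Prob

/-! ### De Bruijn's identity at positive times. -/

/-- The differential entropy of the density `heat μ t`. -/
noncomputable def heatEntropy (μ : Measure ℝ) (t : ℝ) : ℝ := ∫ x, Real.negMulLog (heat μ t x)

/-- The Fisher information of the density `heat μ t`. -/
noncomputable def heatFisher (μ : Measure ℝ) (t : ℝ) : ℝ := ∫ x, heatDeriv μ t x ^ 2 / heat μ t x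

section Prob

variable (μ : Measure ℝ) [IsProbabilityMeasure μ]

/-- Cauchy–Schwarz for the kernel k and k' = -(z / t) k: integrate (z / t + c)² k ≥ 0 with z = x -
y, where c is the logarithmic derivative of f_t at x. Hence J_t is finite for every t > 0. -/
theorem sq_heatDeriv_div_heat_le {t : ℝ} (ht : 0 < t) (x : ℝ) :
    heatDeriv μ t x ^ 2 / heat μ t x ≤ heatConst t * heatMajorant μ t x := by
  set c := heatDeriv μ t x / heat μ t x with hc
  have hpos := heat_pos μ ht x
  have hi0 := integrable_heatKernel_translate μ ht x
  have hi1 := integrable_heatKernelDeriv_translate μ ht x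
  have hib : Integrable (fun y => heatConst t * heatBound t (x - y)) μ :=
    (integrable_heatBound_translate μ ht x).const_mul _
  have h : 0 ≤ ∫ y, (heatConst t * heatBound t (x - y) - 2 * c * heatKernelDeriv t (x - y)
      + c ^ 2 * heatKernel t (x - y)) ∂μ := by
    refine integral_nonneg fun y => ?_
    have h1 := sq_mul_heatKernel_le ht le_rfl le_rfl (x - y)
    have h2 : 0 ≤ ((x - y) / t + c) ^ 2 * heatKernel t (x - y) :=
      mul_nonneg (sq_nonneg _) (heatKernel_pos ht _).le
    simp only [heatKernelDeriv, Pi.zero_apply]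
    nlinarith
  have hid : Integrable (fun y => heatConst t * heatBound t (x - y) -
      2 * c * heatKernelDeriv t (x - y)) μ := hib.sub (hi1.const_mul _)
  rw [integral_add hid (hi0.const_mul _), integral_sub hib (hi1.const_mul _),
    integral_const_mul, integral_const_mul, integral_const_mul] at h
  change 0 ≤ heatConst t * heatMajorant μ t x - 2 * c * heatDeriv μ t x + c ^ 2 * heat μ t x at h
  have h3 : c * heat μ t x = heatDeriv μ t x := by rw [hc]; field_simp
  have h4 : heatDeriv μ t x ^ 2 / heat μ t x = c * heatDeriv μ t x := by rw [hc]; ring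
  have h5 : c ^ 2 * heat μ t x = c * heatDeriv μ t x := by rw [← h3]; ring
  rw [h4]
  linarith

theorem integrable_heatMajorant {b : ℝ} (hb : 0 < b) : Integrable (heatMajorant μ b) := by
  have := (integrable_conv_kernel μ (integrable_heatBound hb)
    (integrable_const (1 : ℝ))).integral_prod_left
  simp only [mul_one] at this
  exact this

theorem integrable_sq_heatDeriv_div_heat {t : ℝ} (ht : 0 < t) :
    Integrable (fun x => heatDeriv μ t x ^ 2 / heat μ t x) := by
  refine ((integrable_heatMajorant μ ht).const_mul (heatConst t)).mono' ?_
    (Eventually.of_forall fun x => ?_)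
  · exact (((continuous_heatDeriv μ ht).pow 2).div (continuous_heat μ ht)
      fun x => (heat_pos μ ht x).ne').aestronglyMeasurable
  · rw [Real.norm_of_nonneg (div_nonneg (sq_nonneg _) (heat_pos μ ht x).le)]
    exact sq_heatDeriv_div_heat_le μ ht x

theorem continuous_log_heat {t : ℝ} (ht : 0 < t) : Continuous fun x => Real.log (heat μ t x) :=
  (continuous_heat μ ht).log fun x => (heat_pos μ ht x).ne'

variable {r : ℝ} (hr : 0 < r) (hμ : Integrable (fun y => Real.log (ballMass μ r y)) μ)

include hr hμ

theorem integrable_log_heat_mul {t K : ℝ} (ht : 0 < t) (hK : 0 ≤ K) {g : ℝ → ℝ} (hgm : Measurable g)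
    (hg : ∀ x, |g x| ≤ K * heatMajorant μ t x) :
    Integrable fun x => (-Real.log (heat μ t x) - 1) * g x := by
  obtain ⟨E, hE, h⟩ := exists_integrable_log_heat_bound μ ht le_rfl hr hμ
  refine (hE.const_mul K).mono' ?_ ?_
  · exact (((continuous_log_heat μ ht).neg.sub continuous_const).measurable.mul
      hgm).aestronglyMeasurable
  · filter_upwards [h] with x hx
    rw [Real.norm_eq_abs, abs_mul]
    calc |-Real.log (heat μ t x) - 1| * |g x|
        ≤ (|Real.log (heat μ t x)| + 1) * (K * heatMajorant μ t x) := by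
          gcongr
          · exact (abs_sub _ _).trans (by simp)
          · exact hg x
      _ = K * ((|Real.log (heat μ t x)| + 1) * heatMajorant μ t x) := by ring
      _ ≤ K * E x := by gcongr; exact hx t le_rfl le_rfl

theorem integrable_negMulLog_heat {t : ℝ} (ht : 0 < t) :
    Integrable fun x => Real.negMulLog (heat μ t x) := by
  have h := integrable_log_heat_mul μ hr hμ ht (heatConst_pos ht).le (measurable_heat μ t)
    fun x => abs_integral_le_heatMajorant μ ht (abs_heatKernel_le ht le_rfl le_rfl) x
  refine (h.add (integrable_heat μ ht)).congr (Eventually.of_forall fun x => ?_)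
  simp only [Pi.add_apply, Real.negMulLog]
  ring

/-- Integration by parts over the line. There are no boundary terms because (-log f_t - 1) f_t' is
itself integrable. -/
theorem integral_log_heat_mul_heatDeriv2 {t : ℝ} (ht : 0 < t) :
    ∫ x, (-Real.log (heat μ t x) - 1) * heatDeriv2 μ t x = heatFisher μ t := by
  have h := integral_mul_deriv_eq_deriv_mul_of_integrable
    (u := fun x => -Real.log (heat μ t x) - 1) (v := heatDeriv μ t)
    (u' := fun x => -(heatDeriv μ t x / heat μ t x)) (v' := heatDeriv2 μ t)
    (fun x _ => (((hasDerivAt_heat μ ht x).log (heat_pos μ ht x).ne').neg).sub_const 1)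
    (fun x _ => hasDerivAt_heatDeriv μ ht x)
    (integrable_log_heat_mul μ hr hμ ht (heatConst_pos ht).le (measurable_heatDeriv2 μ t)
      fun x => abs_integral_le_heatMajorant μ ht (abs_heatKernelDeriv2_le ht le_rfl le_rfl) x)
    ?_
    (integrable_log_heat_mul μ hr hμ ht (heatConst_pos ht).le (continuous_heatDeriv μ ht).measurable
      fun x => abs_integral_le_heatMajorant μ ht (abs_heatKernelDeriv_le ht le_rfl le_rfl) x)
  · rw [h, ← integral_neg, heatFisher]
    congr 1
    funext x
    ring
  · refine (integrable_sq_heatDeriv_div_heat μ ht).neg.congr (Eventually.of_forall fun x => ?_)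
    simp only [Pi.neg_apply, Pi.mul_apply]
    ring

/-- The derivative of -u log u is -log u - 1 and the time derivative of f_t is f_t'' / 2; the bound
E on [t/2, 2t] justifies differentiating under the integral. -/
theorem hasDerivAt_heatEntropy {t : ℝ} (ht : 0 < t) :
    HasDerivAt (heatEntropy μ) (2⁻¹ * heatFisher μ t) t := by
  have h2 : 0 < t / 2 := by positivity
  obtain ⟨E, hE, h⟩ := exists_integrable_log_heat_bound μ h2
    (by linarith : t / 2 ≤ 2 * t) hr hμ
  rw [← integral_log_heat_mul_heatDeriv2 μ hr hμ ht, ← integral_const_mul]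
  have hc := (heatConst_pos h2).le
  refine (hasDerivAt_integral_of_dominated_loc_of_deriv_le (s := Set.Ioo (t / 2) (2 * t))
    (F := fun s x => Real.negMulLog (heat μ s x))
    (F' := fun s x => 2⁻¹ * ((-Real.log (heat μ s x) - 1) * heatDeriv2 μ s x))
    (bound := fun x => heatConst (t / 2) * E x)
    (Ioo_mem_nhds (by linarith) (by linarith)) (Eventually.of_forall fun s => ?_)
    (integrable_negMulLog_heat μ hr hμ ht) ?_ ?_ (hE.const_mul _) ?_).2
  · exact (Real.continuous_negMulLog.measurable.comp (measurable_heat μ s)).aestronglyMeasurable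
  · exact ((((continuous_log_heat μ ht).neg.sub continuous_const).measurable.mul
      (measurable_heatDeriv2 μ t)).const_mul _).aestronglyMeasurable
  · filter_upwards [h] with x hx s hs
    have h3 := abs_integral_le_heatMajorant μ (by positivity : 0 < 2 * t)
      (abs_heatKernelDeriv2_le h2 hs.1.le hs.2.le) x
    change |heatDeriv2 μ s x| ≤ _ at h3
    rw [Real.norm_eq_abs, abs_mul, abs_mul, abs_of_pos (by norm_num : (0 : ℝ) < 2⁻¹)]
    have h4 : |-Real.log (heat μ s x) - 1| ≤ |Real.log (heat μ s x)| + 1 :=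
      (abs_sub _ _).trans (by simp)
    calc 2⁻¹ * (|-Real.log (heat μ s x) - 1| * |heatDeriv2 μ s x|)
        ≤ 1 * ((|Real.log (heat μ s x)| + 1) *
          (heatConst (t / 2) * heatMajorant μ (2 * t) x)) := by
          gcongr
          norm_num
      _ = heatConst (t / 2) * ((|Real.log (heat μ s x)| + 1) * heatMajorant μ (2 * t) x) := by ring
      _ ≤ heatConst (t / 2) * E x := by gcongr; exact hx s hs.1.le hs.2.le
  · refine Eventually.of_forall fun x s hs => ?_
    have hs0 := h2.trans hs.1
    refine ((Real.hasDerivAt_negMulLog (heat_pos μ hs0 x).ne').comp s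
      (hasDerivAt_heat_time μ hs0 x)).congr_deriv ?_
    ring

end Prob

/-! ### Finite entropy of X + Y makes the log-masses of balls integrable. -/

theorem ne_top_of_finite_sub {a b : ℝ≥0∞} (h : ((a : EReal) - (b : EReal)).Finite) :
    a ≠ ⊤ ∧ b ≠ ⊤ := by
  obtain ⟨h1, h2⟩ := h
  have hb : b ≠ ⊤ := by
    rintro rfl
    simp at h1
  refine ⟨?_, hb⟩
  rintro rfl
  lift b to NNReal using hb
  apply h2
  change (⊤ : EReal) - ((b : ℝ) : EReal) = ⊤
  exact EReal.top_sub_coe _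

/-- Split -u log u = -u log v + u log(v / u). The last term is at most v - u, and -u log v is at
most -v log v or 0 according to the sign of log v. -/
theorem negMulLog_le_max_add {u v : ℝ} (hu : 0 < u) (huv : u ≤ v) :
    Real.negMulLog u ≤ max (Real.negMulLog v) 0 + v := by
  have hv := hu.trans_le huv
  have h1 : Real.log v - Real.log u ≤ v / u - 1 := by
    rw [← Real.log_div hv.ne' hu.ne']
    exact Real.log_le_sub_one_of_pos (by positivity)
  have h2 : u * (Real.log v - Real.log u) ≤ v - u := by
    calc _ ≤ u * (v / u - 1) := by gcongr
      _ = v - u := by field_simp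
  have h3 : -u * Real.log v ≤ max (Real.negMulLog v) 0 := by
    rcases le_total (Real.log v) 0 with h | h
    · refine le_max_of_le_left ?_
      simp only [Real.negMulLog]
      nlinarith
    · refine le_max_of_le_right ?_
      nlinarith
  simp only [Real.negMulLog] at *
  linarith

/-- The negative logarithm of the mass of a ball, infinite for a null ball. -/
noncomputable def negLogBall (μ : Measure ℝ) (r y : ℝ) : ℝ≥0∞ :=
  open Classical in
  if ballMass μ r y = 0 then ⊤ else ENNReal.ofReal (-Real.log (ballMass μ r y))

/-- The value ⊤ at null balls is needed here, since `Real.log 0 = 0` would break monotonicity. -/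
theorem negLogBall_anti (μ : Measure ℝ) {r s x y : ℝ} (h : ballMass μ r x ≤ ballMass μ s y) :
    negLogBall μ s y ≤ negLogBall μ r x := by
  have h0 : 0 ≤ ballMass μ r x := measureReal_nonneg
  unfold negLogBall
  by_cases hx : ballMass μ r x = 0
  · simp [hx]
  · have hx' := h0.lt_of_ne' hx
    rw [if_neg hx, if_neg (hx'.trans_le h).ne']
    gcongr

theorem ofReal_le_negLogBall (μ : Measure ℝ) (r y : ℝ) :
    ENNReal.ofReal (-Real.log (ballMass μ r y)) ≤ negLogBall μ r y := by
  unfold negLogBall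
  split_ifs <;> simp

section

variable (μ : Measure ℝ) [IsFiniteMeasure μ]

theorem measurable_negLogBall (r : ℝ) : Measurable (negLogBall μ r) := by
  have h := measurable_ballMass μ r
  exact Measurable.ite (h (measurableSet_singleton 0)) measurable_const (by fun_prop)

/-- Here b is the density of X + Y at w and a its part from a truncated Y. As a ≤ M m with m the
mass of the ball, -log m ≤ log M - log a, and -a log a is controlled by b through
`negMulLog_le_max_add`. -/
theorem mul_negLogBall_le {A M : ℝ} (hM : 1 ≤ M) {w : ℝ} {a b : ℝ≥0∞} (hab : a ≤ b) (hb : b ≠ ⊤)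
    (ha : a ≤ ENNReal.ofReal M * μ (Metric.closedBall w A)) :
    a * negLogBall μ A w ≤
      ENNReal.ofReal (Real.negMulLog b.toReal) + ENNReal.ofReal (1 + Real.log M) * b := by
  have hat : a ≠ ⊤ := ne_top_of_le_ne_top hb hab
  rcases eq_or_ne a 0 with rfl | ha0
  · simp
  have hu : 0 < a.toReal := ENNReal.toReal_pos ha0 hat
  have huv : a.toReal ≤ b.toReal := ENNReal.toReal_mono hb hab
  have hum : a.toReal ≤ M * ballMass μ A w := by
    have := ENNReal.toReal_mono (ENNReal.mul_ne_top ENNReal.ofReal_ne_top (measure_ne_top _ _)) ha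
    rwa [ENNReal.toReal_mul, ENNReal.toReal_ofReal (by linarith)] at this
  have hm : 0 < ballMass μ A w := by
    by_contra! hcon
    nlinarith
  rw [negLogBall, if_neg hm.ne', ← ENNReal.ofReal_toReal hat, ← ENNReal.ofReal_toReal hb,
    ENNReal.toReal_ofReal (hu.le.trans huv),
    ← ENNReal.ofReal_mul hu.le, ← ENNReal.ofReal_mul (by have := Real.log_nonneg hM; linarith)]
  have hlog : Real.log a.toReal ≤ Real.log M + Real.log (ballMass μ A w) := by
    rw [← Real.log_mul (by positivity) hm.ne']
    exact Real.log_le_log hu hum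
  have h1 := negMulLog_le_max_add hu huv
  have h2 : 0 ≤ Real.log M := Real.log_nonneg hM
  have h3 : a.toReal * -Real.log (ballMass μ A w) ≤
      max (Real.negMulLog b.toReal) 0 + (1 + Real.log M) * b.toReal := by
    have h4 : a.toReal * -Real.log (ballMass μ A w) ≤
        a.toReal * (Real.log M - Real.log a.toReal) := by
      gcongr; linarith
    have h5 : a.toReal * Real.log M ≤ b.toReal * Real.log M := by gcongr
    simp only [Real.negMulLog] at *
    linarith
  refine (ENNReal.ofReal_le_ofReal h3).trans (ENNReal.ofReal_add_le.trans ?_)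
  refine add_le_add ?_ le_rfl
  rcases le_total (Real.negMulLog b.toReal) 0 with h | h
  · simp [max_eq_right h]
  · rw [max_eq_left h]

end

/-- Restrict Y to a set S of positive probability on which |Y| and its density q are at most A. The
corresponding part g' of the density of X + Y satisfies g'(w) ≤ A μ(B(w, A)), so finiteness of the
positive part of the entropy integral bounds the integral of -log μ(B(w, A)) against g'. Returning
from w = x + y to x costs a doubling of the radius. -/
theorem exists_integrable_log_ballMass (μ ν : Measure ℝ) [IsProbabilityMeasure μ]
    [IsProbabilityMeasure ν] (hν : ν ≪ volume) (h : (differentialEntropyLaw (μ ∗ ν)).Finite) :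
    ∃ r : ℝ, 0 < r ∧ Integrable (fun y => Real.log (ballMass μ r y)) μ := by
  set q := ν.rnDeriv volume with hq
  have hqm : Measurable q := Measure.measurable_rnDeriv _ _
  have hνq : volume.withDensity q = ν := Measure.withDensity_rnDeriv_eq _ _ hν
  have hprob : IsProbabilityMeasure (μ ∗ ν) := inferInstance
  rw [← hνq, conv_withDensity μ hqm] at h hprob
  set g : ℝ → ℝ≥0∞ := fun w => ∫⁻ x, q (w - x) ∂μ with hg
  have hgm : Measurable g :=
    Measurable.lintegral_prod_right' (f := fun p : ℝ × ℝ => q (p.1 - p.2)) (by fun_prop)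
  rw [differentialEntropyLaw_withDensity hgm] at h
  have hent := (ne_top_of_finite_sub h).1
  have hg1 : ∫⁻ w, g w = 1 := by
    have := hprob.measure_univ
    rwa [withDensity_apply _ MeasurableSet.univ, setLIntegral_univ] at this
  have hgfin : ∀ᵐ w, g w < ⊤ := ae_lt_top hgm (by simp [hg1])
  set S : ℕ → Set ℝ := fun n => {y | |y| ≤ n + 1 ∧ q y ≤ n + 1} with hS
  have hSm : ∀ n, MeasurableSet (S n) := fun n =>
    (measurableSet_le measurable_id.abs measurable_const).inter
      (measurableSet_le hqm measurable_const)
  obtain ⟨n, hn⟩ : ∃ n, ν (S n) ≠ 0 := by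
    by_contra! hcon
    have h1 : ν (⋃ n, S n) = 0 := measure_iUnion_null hcon
    have h2 : ∀ᵐ y ∂ν, y ∈ ⋃ n, S n := by
      have h3 : ∀ᵐ y ∂ν, q y < ⊤ := hν.ae_le (Measure.rnDeriv_lt_top ν volume)
      filter_upwards [h3] with y hy
      obtain ⟨k, hk⟩ := exists_nat_ge (max |y| (q y).toReal)
      refine Set.mem_iUnion.2 ⟨k, ⟨?_, ?_⟩⟩
      · have := (le_max_left _ _).trans hk
        linarith
      · have h4 := (le_max_right _ _).trans hk
        have h5 : q y ≤ k := by
          rw [← ENNReal.ofReal_toReal hy.ne, ← ENNReal.ofReal_natCast k]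
          exact ENNReal.ofReal_le_ofReal h4
        exact h5.trans (by simp)
    rw [ae_iff] at h2
    have h6 : ν Set.univ ≤ ν (⋃ n, S n) + ν (⋃ n, S n)ᶜ := by
      rw [← Set.union_compl_self (⋃ n, S n)]
      exact measure_union_le _ _
    rw [h1, show ν (⋃ n, S n)ᶜ = 0 from h2] at h6
    simp at h6
  set A : ℝ := n + 1 with hA
  have hA0 : 0 < A := by positivity
  set p : ℝ → ℝ≥0∞ := (S n).indicator q with hp
  have hpm : Measurable p := hqm.indicator (hSm n)
  set g' : ℝ → ℝ≥0∞ := fun w => ∫⁻ x, p (w - x) ∂μ with hg'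
  have hg'm : Measurable g' :=
    Measurable.lintegral_prod_right' (f := fun z : ℝ × ℝ => p (z.1 - z.2)) (by fun_prop)
  have hg'g : ∀ w, g' w ≤ g w := fun w =>
    lintegral_mono fun x => Set.indicator_le_self _ _ _
  have hg'b : ∀ w, g' w ≤ ENNReal.ofReal A * μ (Metric.closedBall w A) := by
    intro w
    calc g' w ≤ ∫⁻ x, (Metric.closedBall w A).indicator (fun _ => ENNReal.ofReal A) x ∂μ := by
          refine lintegral_mono fun x => ?_
          simp only [hp]
          refine Set.indicator_apply_le' (fun hx => ?_) fun _ => zero_le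
          have hx1 : x ∈ Metric.closedBall w A := by
            rw [Metric.mem_closedBall, Real.dist_eq, abs_sub_comm]
            exact hx.1
          rw [Set.indicator_of_mem hx1]
          refine hx.2.trans (le_of_eq ?_)
          rw [hA, ENNReal.ofReal_add (by positivity) (by positivity)]
          simp
      _ = _ := by
          rw [lintegral_indicator Metric.isClosed_closedBall.measurableSet, setLIntegral_const]
  have hlt : ∫⁻ w, g' w * negLogBall μ A w < ⊤ := by
    calc ∫⁻ w, g' w * negLogBall μ A w
        ≤ ∫⁻ w, (ENNReal.ofReal (Real.negMulLog (g w).toReal) +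
            ENNReal.ofReal (1 + Real.log A) * g w) := by
          refine lintegral_mono_ae ?_
          filter_upwards [hgfin] with w hw
          exact mul_negLogBall_le μ (by rw [hA]; linarith [n.cast_nonneg (α := ℝ)]) (hg'g w) hw.ne
            (hg'b w)
      _ = (∫⁻ w, ENNReal.ofReal (Real.negMulLog (g w).toReal)) +
            ENNReal.ofReal (1 + Real.log A) * 1 := by
          rw [lintegral_add_right _ (by fun_prop), lintegral_const_mul _ hgm, hg1]
      _ < ⊤ := ENNReal.add_lt_top.2 ⟨hent.lt_top, by simp⟩
  have hΦm := measurable_negLogBall μ A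
  have heq : ∫⁻ w, g' w * negLogBall μ A w =
      ∫⁻ x, ∫⁻ y, p y * negLogBall μ A (x + y) ∂volume ∂μ := by
    have h1 := lintegral_withDensity_eq_lintegral_mul volume hg'm hΦm
    simp only [Pi.mul_apply] at h1
    rw [← h1, ← conv_withDensity μ hpm, Measure.lintegral_conv hΦm]
    refine lintegral_congr fun x => ?_
    rw [lintegral_withDensity_eq_lintegral_mul _ hpm (by fun_prop)]
    rfl
  -- For |y| ≤ A the ball B(x + y, A) lies in B(x, 2A).
  have hge : ∫⁻ x, ν (S n) * negLogBall μ (2 * A) x ∂μ ≤ ∫⁻ w, g' w * negLogBall μ A w := by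
    rw [heq]
    refine lintegral_mono fun x => ?_
    have h1 : ν (S n) = ∫⁻ y, p y := by
      rw [← hνq, withDensity_apply _ (hSm n), hp, lintegral_indicator (hSm n)]
    rw [h1, ← lintegral_mul_const _ hpm]
    refine lintegral_mono fun y => ?_
    by_cases hy : y ∈ S n
    · refine mul_le_mul_right ?_ _
      refine negLogBall_anti μ (measureReal_mono ?_)
      refine Metric.closedBall_subset_closedBall' ?_
      have : |y| ≤ A := hy.1
      rw [Real.dist_eq]
      simp only [add_sub_cancel_left]
      linarith
    · simp [hp, hy]
  rw [lintegral_const_mul _ (measurable_negLogBall μ _)] at hge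
  have hfin : ∫⁻ x, negLogBall μ (2 * A) x ∂μ < ⊤ := by
    by_contra! hcon
    rw [top_le_iff] at hcon
    rw [hcon, ENNReal.mul_top hn] at hge
    exact (hge.trans_lt hlt).ne rfl
  refine ⟨2 * A, by positivity, ?_, ?_⟩
  · exact (measurable_ballMass μ _).log.aestronglyMeasurable
  · refine lt_of_le_of_lt (lintegral_mono fun x => ?_) hfin
    refine le_trans (le_of_eq ?_) (ofReal_le_negLogBall μ _ x)
    rw [← ofReal_norm, Real.norm_eq_abs, abs_of_nonpos]
    exact Real.log_nonpos measureReal_nonneg (ballMass_le_one μ _ _)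

/-! ### Absolutely continuous densities: smoothing does not increase Fisher information. -/

theorem integrable_heatKernel_mul {s : ℝ} (hs : 0 < s) {g : ℝ → ℝ} (hg : Integrable g) :
    Integrable (fun p : ℝ × ℝ => heatKernel s (p.1 - p.2) * g p.2) (volume.prod volume) := by
  refine (hg.convolution_integrand (ContinuousLinearMap.mul ℝ ℝ)
    (integrable_heatKernel hs)).congr (Eventually.of_forall fun p => ?_)
  simp [mul_comm]

theorem integral_heatKernel_mul {s : ℝ} (hs : 0 < s) {g : ℝ → ℝ} (hg : Integrable g) :
    ∫ x, ∫ y, heatKernel s (x - y) * g y = ∫ y, g y := by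
  rw [integral_integral_swap (integrable_heatKernel_mul hs hg)]
  refine integral_congr_ae (Eventually.of_forall fun y => ?_)
  simp only
  rw [integral_mul_const, integral_sub_right_eq_self, integral_heatKernel hs, one_mul]

namespace IsACDensity

variable {μ : Measure ℝ} {f : ℝ → ℝ}

theorem sub_eq_integral (hf : IsACDensity μ f) (a b : ℝ) :
    f b - f a = ∫ x in a..b, deriv f x := ((hf.absCont a b).integral_deriv_eq_sub).symm

theorem deriv_eq_zero (hf : IsACDensity μ f) {x : ℝ} (hx : f x = 0) : deriv f x = 0 := by
  have h : IsLocalMin f x := Eventually.of_forall fun y => by rw [hx]; exact hf.nonneg y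
  exact h.deriv_eq_zero

/-- The expression is (f' - c f)² / f; at a zero of f, a minimum, f' vanishes too and every term is
0. Integrated against a kernel with a suitable c, it replaces Cauchy–Schwarz. -/
theorem sq_sub_nonneg (hf : IsACDensity μ f) (c x : ℝ) :
    0 ≤ deriv f x ^ 2 / f x - 2 * c * deriv f x + c ^ 2 * f x := by
  rcases (hf.nonneg x).eq_or_lt with h | h
  · simp [← h, hf.deriv_eq_zero h.symm]
  · have : deriv f x ^ 2 / f x - 2 * c * deriv f x + c ^ 2 * f x =
        (deriv f x - c * f x) ^ 2 / f x := by
      field_simp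
      ring
    rw [this]
    positivity

theorem abs_deriv_le (hf : IsACDensity μ f) (x : ℝ) :
    |deriv f x| ≤ deriv f x ^ 2 / f x + f x := by
  have h1 := hf.sq_sub_nonneg 1 x
  have h2 := hf.sq_sub_nonneg (-1) x
  have h3 : 0 ≤ deriv f x ^ 2 / f x := div_nonneg (sq_nonneg _) (hf.nonneg x)
  have := hf.nonneg x
  rw [abs_le]
  constructor <;> linarith

theorem integrable [IsFiniteMeasure μ] (hf : IsACDensity μ f) : Integrable f := by
  refine ⟨hf.continuous.aestronglyMeasurable, ?_⟩
  have h : ∫⁻ x, ENNReal.ofReal (f x) = μ Set.univ := by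
    rw [hf.eq_withDensity, withDensity_apply _ MeasurableSet.univ, setLIntegral_univ]
  rw [hasFiniteIntegral_iff_ofReal (Eventually.of_forall hf.nonneg), h]
  exact measure_lt_top _ _

theorem integral_eq (hf : IsACDensity μ f) (g : ℝ → ℝ) : ∫ x, g x ∂μ = ∫ x, f x * g x := by
  conv_lhs => rw [hf.eq_withDensity]
  exact integral_withDensity_ofReal hf.continuous.measurable hf.nonneg g

theorem integral_eq_one [IsProbabilityMeasure μ] (hf : IsACDensity μ f) : ∫ x, f x = 1 := by
  have := hf.integral_eq fun _ => 1
  simpa using this.symm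

theorem integrable_iff (hf : IsACDensity μ f) {g : ℝ → ℝ} :
    Integrable g μ ↔ Integrable fun x => f x * g x := by
  conv_lhs => rw [hf.eq_withDensity]
  exact integrable_withDensity_ofReal_iff hf.continuous.measurable hf.nonneg

variable (hI : ∫⁻ x, ENNReal.ofReal (deriv f x ^ 2 / f x) ≠ ⊤)

include hI

theorem integrable_sq_deriv_div (hf : IsACDensity μ f) :
    Integrable fun x => deriv f x ^ 2 / f x := by
  refine ⟨(((measurable_deriv f).pow_const 2).div
    hf.continuous.measurable).aestronglyMeasurable, ?_⟩
  rw [hasFiniteIntegral_iff_ofReal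
    (Eventually.of_forall fun x => div_nonneg (sq_nonneg _) (hf.nonneg x))]
  exact hI.lt_top

theorem integrable_deriv [IsFiniteMeasure μ] (hf : IsACDensity μ f) : Integrable (deriv f) :=
  ((hf.integrable_sq_deriv_div hI).add hf.integrable).mono'
    (measurable_deriv f).aestronglyMeasurable (Eventually.of_forall hf.abs_deriv_le)

theorem exists_bound [IsFiniteMeasure μ] (hf : IsACDensity μ f) : ∃ B : ℝ, ∀ x, f x ≤ B := by
  refine ⟨f 0 + ∫ x, ‖deriv f x‖, fun x => ?_⟩
  have h1 := hf.sub_eq_integral 0 x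
  have h2 : ∫ u in 0..x, deriv f u ≤ ∫ u, ‖deriv f u‖ := by
    have h3 : ‖∫ u in 0..x, deriv f u‖ ≤ ∫ u in Set.uIoc 0 x, ‖deriv f u‖ :=
      intervalIntegral.norm_integral_le_integral_norm_uIoc
    refine (Real.le_norm_self _).trans (h3.trans ?_)
    exact setIntegral_le_integral (hf.integrable_deriv hI).norm
      (Eventually.of_forall fun _ => norm_nonneg _)
  linarith

/-- Moves the derivative from the kernel to f. Fubini shows that f_t is a primitive of the
continuous function k * f', where k is the kernel, and derivatives are unique. -/
theorem heatDeriv_eq [IsFiniteMeasure μ] (hf : IsACDensity μ f) {t : ℝ} (ht : 0 < t) (x : ℝ) :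
    heatDeriv μ t x = ∫ y, heatKernel t (x - y) * deriv f y := by
  set G : ℝ → ℝ := fun u => ∫ y, heatKernel t (u - y) * deriv f y with hG
  have hd := hf.integrable_deriv hI
  have hGc : Continuous G := by
    refine continuous_of_dominated (bound := fun y => (√(2 * Real.pi * t))⁻¹ * ‖deriv f y‖)
      (fun u => ?_) (fun u => Eventually.of_forall fun y => ?_) (hd.norm.const_mul _)
      (Eventually.of_forall fun y => by fun_prop)
    · exact (((continuous_heatKernel t).comp (by fun_prop)).measurable.mul
        (measurable_deriv f)).aestronglyMeasurable
    · rw [norm_mul, Real.norm_of_nonneg (heatKernel_pos ht _).le]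
      gcongr
      exact heatKernel_le ht _
  have hheat : ∀ u, heat μ t u = ∫ z, heatKernel t z * f (u - z) := by
    intro u
    rw [heat, hf.integral_eq, ← integral_sub_left_eq_self _ volume u]
    simp [mul_comm]
  have hGz : ∀ u, G u = ∫ z, heatKernel t z * deriv f (u - z) := by
    intro u
    simp only [hG]
    rw [← integral_sub_left_eq_self _ volume u]
    simp
  have hint : ∀ u, Integrable fun z => heatKernel t z * f (u - z) := fun u =>
    (hf.integrable.comp_sub_left u).bdd_mul (continuous_heatKernel t).aestronglyMeasurable
      (Eventually.of_forall fun z => by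
        rw [Real.norm_of_nonneg (heatKernel_pos ht _).le]
        exact heatKernel_le ht _)
  have hprod : Integrable (fun p : ℝ × ℝ => heatKernel t p.2 * deriv f (p.1 - p.2))
      (volume.prod volume) := by
    exact (integrable_heatKernel ht).convolution_integrand (ContinuousLinearMap.mul ℝ ℝ) hd
  have hinc : ∀ b, heat μ t b = heat μ t 0 + ∫ u in 0..b, G u := by
    intro b
    rw [← sub_eq_iff_eq_add', hheat, hheat, ← integral_sub (hint b) (hint 0)]
    simp_rw [hGz]
    rw [intervalIntegral_integral_swap]
    · refine integral_congr_ae (Eventually.of_forall fun z => ?_)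
      simp only
      rw [intervalIntegral.integral_const_mul, ← mul_sub, hf.sub_eq_integral,
        intervalIntegral.integral_comp_sub_right]
    · rw [Function.uncurry_def]
      refine hprod.mono_measure ?_
      exact Measure.prod_mono Measure.restrict_le_self le_rfl
  have hder : HasDerivAt (heat μ t) (G x) x := by
    have h1 : HasDerivAt (fun b => heat μ t 0 + ∫ u in 0..b, G u) (G x) x :=
      (intervalIntegral.integral_hasDerivAt_right (hGc.intervalIntegrable _ _)
        (hGc.stronglyMeasurableAtFilter _ _) hGc.continuousAt).const_add _
    rwa [← funext hinc] at h1
  exact (hasDerivAt_heat μ ht x).unique hder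

/-- Pointwise, (k * f')² / (k * f) ≤ k * (f'² / f), by `sq_sub_nonneg` with c the logarithmic
derivative of f_t at x; then integrate in x. -/
theorem heatFisher_le [IsProbabilityMeasure μ] (hf : IsACDensity μ f) {t : ℝ} (ht : 0 < t) :
    heatFisher μ t ≤ ∫ x, deriv f x ^ 2 / f x := by
  have hD := hf.integrable_sq_deriv_div hI
  have hd := hf.integrable_deriv hI
  have hle : ∀ᵐ x, heatDeriv μ t x ^ 2 / heat μ t x ≤
      ∫ y, heatKernel t (x - y) * (deriv f y ^ 2 / f y) := by
    filter_upwards [(integrable_heatKernel_mul ht hD).prod_right_ae,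
      (integrable_heatKernel_mul ht hd).prod_right_ae,
      (integrable_heatKernel_mul ht hf.integrable).prod_right_ae] with x hx1 hx2 hx3
    set c := heatDeriv μ t x / heat μ t x with hc
    have hpos := heat_pos μ ht x
    have h : 0 ≤ ∫ y, (heatKernel t (x - y) * (deriv f y ^ 2 / f y) -
        2 * c * (heatKernel t (x - y) * deriv f y) + c ^ 2 * (heatKernel t (x - y) * f y)) := by
      refine integral_nonneg fun y => ?_
      have := mul_nonneg (heatKernel_pos ht (x - y)).le (hf.sq_sub_nonneg c y)
      simp only [Pi.zero_apply]
      linarith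
    have hx12 : Integrable fun y => heatKernel t (x - y) * (deriv f y ^ 2 / f y) -
        2 * c * (heatKernel t (x - y) * deriv f y) := hx1.sub (hx2.const_mul _)
    rw [integral_add hx12 (hx3.const_mul _), integral_sub hx1 (hx2.const_mul _),
      integral_const_mul, integral_const_mul, ← hf.heatDeriv_eq hI ht] at h
    have hheat : ∫ y, heatKernel t (x - y) * f y = heat μ t x := by
      rw [heat, hf.integral_eq]
      simp [mul_comm]
    rw [hheat] at h
    have h3 : c * heat μ t x = heatDeriv μ t x := by rw [hc]; field_simp
    have h4 : heatDeriv μ t x ^ 2 / heat μ t x = c * heatDeriv μ t x := by rw [hc]; ring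
    have h5 : c ^ 2 * heat μ t x = c * heatDeriv μ t x := by rw [← h3]; ring
    rw [h4]
    linarith
  calc heatFisher μ t ≤ ∫ x, ∫ y, heatKernel t (x - y) * (deriv f y ^ 2 / f y) :=
        integral_mono_ae (integrable_sq_heatDeriv_div_heat μ ht)
          (integrable_heatKernel_mul ht hD).integral_prod_left hle
    _ = _ := integral_heatKernel_mul ht hD

end IsACDensity

/-! ### Lower semicontinuity of Fisher information as t tends to 0. -/

theorem exists_weakly_convergent_subseq {H : Type*} [NormedAddCommGroup H] [InnerProductSpace ℝ H]
    [CompleteSpace H] [TopologicalSpace.SeparableSpace H] {w : ℕ → H} {R : ℝ}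
    (hw : ∀ n, ‖w n‖ ≤ R) :
    ∃ W : H, ‖W‖ ≤ R ∧ ∃ φ : ℕ → ℕ, StrictMono φ ∧
      ∀ v, Tendsto (fun n => inner ℝ (w (φ n)) v) atTop (𝓝 (inner ℝ W v)) := by
  obtain ⟨l, hl, φ, hφ, hlim⟩ := WeakDual.isSeqCompact_closedBall ℝ H 0 R
    (x := fun n => StrongDual.toWeakDual (InnerProductSpace.toDual ℝ H (w n)))
    (fun n => by simpa using hw n)
  refine ⟨(InnerProductSpace.toDual ℝ H).symm (WeakDual.toStrongDual l), ?_, φ, hφ, fun v => ?_⟩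
  · rw [LinearIsometryEquiv.norm_map]
    simpa using hl
  · have h := ((WeakDual.eval_continuous v).tendsto l).comp hlim
    rw [InnerProductSpace.toDual_symm_apply]
    exact h

/-- Makes interval integrals weakly continuous in v. One of the two indicators is always zero, which
covers both orders of a and b. -/
theorem intervalIntegral_eq_inner (v : Lp ℝ 2 (volume : Measure ℝ)) (a b : ℝ) :
    ∫ x in a..b, v x =
      inner ℝ v (indicatorConstLp 2 (μ := volume)
        (measurableSet_Ioc (a := a) (b := b)) (by simp) (1 : ℝ))
      - inner ℝ v (indicatorConstLp 2 (μ := volume)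
        (measurableSet_Ioc (a := b) (b := a)) (by simp) (1 : ℝ)) := by
  rw [real_inner_comm, L2.inner_indicatorConstLp_one, real_inner_comm,
    L2.inner_indicatorConstLp_one]
  rfl

theorem abs_intervalIntegral_le (v : Lp ℝ 2 (volume : Measure ℝ)) (a b : ℝ) :
    |∫ x in a..b, v x| ≤ ‖v‖ * √|b - a| := by
  wlog hab : a ≤ b generalizing a b
  · rw [intervalIntegral.integral_symm, abs_neg, abs_sub_comm]
    exact this b a (not_le.1 hab).le
  rw [intervalIntegral.integral_of_le hab,
    ← L2.inner_indicatorConstLp_one (𝕜 := ℝ) measurableSet_Ioc (by simp)]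
  refine (abs_real_inner_le_norm _ _).trans (le_of_eq ?_)
  rw [norm_indicatorConstLp (by simp) (by simp), mul_comm, abs_of_nonneg (sub_nonneg.2 hab)]
  simp [measureReal_def, Real.sqrt_eq_rpow, hab]

section

variable (μ : Measure ℝ) [IsProbabilityMeasure μ]

theorem map_prod_gaussianReal {s : ℝ} (hs : 0 < s) :
    (μ.prod (gaussianReal 0 1)).map (fun p => p.1 + √s * p.2) =
      volume.withDensity fun x => ENNReal.ofReal (heat μ s x) := by
  rw [← conv_gaussianReal μ hs]
  have h : gaussianReal 0 s.toNNReal = (gaussianReal 0 1).map (fun z => √s * z) := by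
    rw [gaussianReal_map_const_mul]
    congr 1
    · simp
    · ext; simp [hs.le]
  rw [h, Measure.conv, ← Measure.map_id (μ := μ),
    Measure.map_prod_map _ _ (by fun_prop) (by fun_prop),
    Measure.map_map (by fun_prop) (by fun_prop), Measure.map_id]
  rfl

theorem integral_heat_mul {s : ℝ} (hs : 0 < s) {g : ℝ → ℝ} (hg : Measurable g) :
    ∫ x, heat μ s x * g x = ∫ p, g (p.1 + √s * p.2) ∂(μ.prod (gaussianReal 0 1)) := by
  have h : ∫ p, g (p.1 + √s * p.2) ∂(μ.prod (gaussianReal 0 1)) =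
      ∫ x, g x ∂((μ.prod (gaussianReal 0 1)).map (fun p => p.1 + √s * p.2)) :=
    (integral_map (by fun_prop) hg.aestronglyMeasurable).symm
  rw [h, map_prod_gaussianReal μ hs,
    integral_withDensity_ofReal (measurable_heat μ s) (heat_nonneg μ hs)]

theorem integrable_heat_mul {s : ℝ} (hs : 0 < s) {g : ℝ → ℝ} (hg : Measurable g)
    (hi : Integrable (fun p => g (p.1 + √s * p.2)) (μ.prod (gaussianReal 0 1))) :
    Integrable fun x => heat μ s x * g x := by
  have h : Integrable g ((μ.prod (gaussianReal 0 1)).map (fun p => p.1 + √s * p.2)) :=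
    (integrable_map_measure hg.aestronglyMeasurable (by fun_prop)).2 hi
  rwa [map_prod_gaussianReal μ hs,
    integrable_withDensity_ofReal_iff (measurable_heat μ s) (heat_nonneg μ hs)] at h

/-- All times share the same pair (X, Z), so X + √t Z → X pointwise and dominated convergence
applies, also to unbounded g. -/
theorem tendsto_integral_comp_add {t : ℕ → ℝ} (ht0 : Tendsto t atTop (𝓝 0)) {g : ℝ → ℝ}
    {G : ℝ × ℝ → ℝ} (hg : Continuous g) (hG : Integrable G (μ.prod (gaussianReal 0 1)))
    (hb : ∀ n, ∀ᵐ p ∂(μ.prod (gaussianReal 0 1)), |g (p.1 + √(t n) * p.2)| ≤ G p) :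
    Tendsto (fun n => ∫ p, g (p.1 + √(t n) * p.2) ∂(μ.prod (gaussianReal 0 1))) atTop
      (𝓝 (∫ x, g x ∂μ)) := by
  have h : ∫ x, g x ∂μ = ∫ p, g p.1 ∂(μ.prod (gaussianReal 0 1)) := by
    rw [integral_fun_fst]; simp
  rw [h]
  refine tendsto_integral_of_dominated_convergence G
    (fun n => (hg.comp (by fun_prop)).aestronglyMeasurable) hG hb (Eventually.of_forall fun p => ?_)
  have h1 : Tendsto (fun n => p.1 + √(t n) * p.2) atTop (𝓝 (p.1 + √0 * p.2)) :=
    (((Real.continuous_sqrt.tendsto 0).comp ht0).mul_const _).const_add _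
  rw [Real.sqrt_zero, zero_mul, add_zero] at h1
  exact (hg.tendsto _).comp h1

theorem memLp_heatDeriv_div_sqrt {t : ℝ} (ht : 0 < t) :
    MemLp (fun x => heatDeriv μ t x / (2 * √(heat μ t x))) 2 volume := by
  have hc : Continuous fun x => heatDeriv μ t x / (2 * √(heat μ t x)) :=
    (continuous_heatDeriv μ ht).div ((continuous_heat μ ht).sqrt.const_mul 2)
      fun x => by have := heat_pos μ ht x; positivity
  rw [memLp_two_iff_integrable_sq hc.aestronglyMeasurable]
  refine ((integrable_sq_heatDeriv_div_heat μ ht).const_mul 4⁻¹).congr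
    (Eventually.of_forall fun x => ?_)
  simp only
  rw [div_pow, mul_pow, Real.sq_sqrt (heat_nonneg μ ht x)]
  have := heat_pos μ ht x
  field_simp
  ring

/-- The derivative of the square root of `heat μ t`, as an element of `L²`. -/
noncomputable def sqrtHeatDeriv {t : ℝ} (ht : 0 < t) : Lp ℝ 2 (volume : Measure ℝ) :=
  (memLp_heatDeriv_div_sqrt μ ht).toLp _

theorem coeFn_sqrtHeatDeriv {t : ℝ} (ht : 0 < t) :
    sqrtHeatDeriv μ ht =ᵐ[volume] fun x => heatDeriv μ t x / (2 * √(heat μ t x)) :=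
  (memLp_heatDeriv_div_sqrt μ ht).coeFn_toLp

theorem norm_sqrtHeatDeriv_le {t a : ℝ} (ht : 0 < t) (ha : heatFisher μ t ≤ a) :
    ‖sqrtHeatDeriv μ ht‖ ≤ √(a / 4) := by
  refine Real.le_sqrt_of_sq_le ?_
  rw [← real_inner_self_eq_norm_sq, L2.inner_def]
  have h : ∫ x, inner ℝ (sqrtHeatDeriv μ ht x) (sqrtHeatDeriv μ ht x) = heatFisher μ t / 4 := by
    rw [heatFisher, ← integral_div]
    refine integral_congr_ae ?_
    filter_upwards [coeFn_sqrtHeatDeriv μ ht] with x hx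
    rw [hx]
    rw [real_inner_self_eq_norm_sq, Real.norm_eq_abs, sq_abs, div_pow, mul_pow,
      Real.sq_sqrt (heat_nonneg μ ht x)]
    have := heat_pos μ ht x
    field_simp
    norm_num
  rw [h]
  linarith

theorem sqrt_heat_sub {t : ℝ} (ht : 0 < t) (a b : ℝ) :
    √(heat μ t b) - √(heat μ t a) = ∫ x in a..b, sqrtHeatDeriv μ ht x := by
  have hc : Continuous fun x => heatDeriv μ t x / (2 * √(heat μ t x)) :=
    (continuous_heatDeriv μ ht).div ((continuous_heat μ ht).sqrt.const_mul 2)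
      fun x => by have := heat_pos μ ht x; positivity
  rw [← intervalIntegral.integral_eq_sub_of_hasDerivAt
    (fun x _ => (hasDerivAt_heat μ ht x).sqrt (heat_pos μ ht x).ne') (hc.intervalIntegrable _ _)]
  refine intervalIntegral.integral_congr_ae ?_
  filter_upwards [coeFn_sqrtHeatDeriv μ ht] with x hx _
  rw [hx]

/-- Supplies a base point in a fixed compact set, from which the Hölder bound on √f_t becomes a
bound on its values uniform in t. -/
theorem exists_heat_le_one {t : ℝ} (ht : 0 < t) : ∃ x ∈ Set.Icc (0 : ℝ) 1, heat μ t x ≤ 1 := by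
  obtain ⟨x, hx, h⟩ := exists_le_setAverage (μ := volume) (s := Set.Icc (0 : ℝ) 1) (by simp)
    (by simp) (integrable_heat μ ht).integrableOn
  refine ⟨x, hx, h.trans ?_⟩
  rw [setAverage_eq]
  simp only [Real.volume_real_Icc, sub_zero, zero_le_one, sup_of_le_left, inv_one, one_smul]
  rw [← integral_heat μ ht]
  exact setIntegral_le_integral (integrable_heat μ ht) (Eventually.of_forall (heat_nonneg μ ht))

/-- Since J_t = 4‖(√f_t)'‖², a subsequence of these derivatives converges weakly in L² to some W
with 4‖W‖² ≤ a. The functions √f_t then converge pointwise to a primitive G of W, and G² is the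
density of μ because X + √t Z converges in law to X. -/
theorem fisherInfoLaw_le_of_heatFisher_le {t : ℕ → ℝ} (ht : ∀ n, 0 < t n)
    (ht0 : Tendsto t atTop (𝓝 0)) {a : ℝ} (ha0 : 0 ≤ a) (ha : ∀ n, heatFisher μ (t n) ≤ a) :
    fisherInfoLaw μ ≤ ENNReal.ofReal a := by
  set w : ℕ → Lp ℝ 2 (volume : Measure ℝ) :=
    fun n => sqrtHeatDeriv μ (ht n) with hw
  set R := √(a / 4) with hR
  have hwR : ∀ n, ‖w n‖ ≤ R := fun n => norm_sqrtHeatDeriv_le μ (ht n) (ha n)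
  have : Fact ((2 : ℝ≥0∞) ≠ ⊤) := ⟨by simp⟩
  obtain ⟨W, hWR, φ, hφ, hlim⟩ := exists_weakly_convergent_subseq hwR
  have hbound : ∀ n x, √(heat μ (t n) x) ≤ 1 + R * √(|x| + 1) := by
    intro n x
    obtain ⟨y, hy, hy1⟩ := exists_heat_le_one μ (ht n)
    have h1 := sqrt_heat_sub μ (ht n) y x
    have h2 := abs_intervalIntegral_le (w n) y x
    have h3 : √(heat μ (t n) y) ≤ 1 := Real.sqrt_le_one.2 hy1
    have h4 : |x - y| ≤ |x| + 1 := by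
      refine (abs_sub _ _).trans ?_
      gcongr
      exact abs_le.2 ⟨by linarith [hy.1], hy.2⟩
    have h5 : ‖w n‖ * √|x - y| ≤ R * √(|x| + 1) := by
      gcongr
      exact hwR n
    have h6 := le_abs_self (∫ u in y..x, w n u)
    simp only [hw] at h6 h5 h2
    linarith
  -- Weak convergence gives only the increments of the limit, so the value at 0 needs one more
  -- extraction.
  obtain ⟨G0, -, ψ, hψ, hG0⟩ :=
    (isCompact_Icc (a := (0 : ℝ)) (b := 1 + R * √(|(0 : ℝ)| + 1))).tendsto_subseq
    (x := fun n => √(heat μ (t (φ n)) 0)) (fun n => ⟨Real.sqrt_nonneg _, hbound _ 0⟩)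
  set G : ℝ → ℝ := fun x => G0 + ∫ u in 0..x, W u with hG
  have hGlim : ∀ x, Tendsto (fun n => √(heat μ (t (φ (ψ n))) x)) atTop (𝓝 (G x)) := by
    intro x
    have h1 : Tendsto (fun n => ∫ u in 0..x, w (φ (ψ n)) u) atTop (𝓝 (∫ u in 0..x, W u)) := by
      simp_rw [intervalIntegral_eq_inner]
      exact ((hlim _).sub (hlim _)).comp hψ.tendsto_atTop
    refine (hG0.add h1).congr fun n => ?_
    simp only [hw, ← sqrt_heat_sub, Function.comp]
    ring
  have hWint : ∀ b c, IntervalIntegrable W volume b c := fun b c => by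
    rw [intervalIntegrable_iff]
    exact (Lp.memLp W).locallyIntegrable (by norm_num) |>.integrableOn_isCompact isCompact_uIcc
      |>.mono_set Set.uIoc_subset_uIcc
  have hGac : ∀ b c, AbsolutelyContinuousOnInterval G b c := by
    intro b c
    have h1 := (hWint (min (min b c) 0)
      (max (max b c) 0)).absolutelyContinuousOnInterval_intervalIntegral
      (c := 0) (by rw [Set.mem_uIcc]; left; simp)
    have h2 : AbsolutelyContinuousOnInterval (fun _ : ℝ => G0) b c :=
      (LipschitzWith.const G0 : LipschitzWith 0 _).lipschitzOnWith.absolutelyContinuousOnInterval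
    refine h2.fun_add (h1.mono ?_)
    rw [Set.uIcc, Set.uIcc_of_le (by simp)]
    exact Set.Icc_subset_Icc (min_le_left _ _) (le_max_left _ _)
  have hGc : Continuous G := (intervalIntegral.continuous_primitive hWint 0).const_add G0
  have hFlim : ∀ x, Tendsto (fun n => heat μ (t (φ (ψ n))) x) atTop (𝓝 (G x * G x)) := by
    intro x
    refine ((hGlim x).mul (hGlim x)).congr fun n => ?_
    exact Real.mul_self_sqrt (heat_nonneg μ (ht _) x)
  have hF : IsACDensity μ (fun x => G x * G x) := by
    refine ⟨fun x => mul_self_nonneg _, fun b c => (hGac b c).fun_mul (hGac b c), ?_⟩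
    have : IsLocallyFiniteMeasure (volume.withDensity fun x => ENNReal.ofReal (G x * G x)) :=
      IsLocallyFiniteMeasure.withDensity_ofReal (by fun_prop)
    refine Measure.ext_of_integral_eq_on_compactlySupported fun g => ?_
    have hgc : Continuous fun x => g x := g.continuous
    obtain ⟨B, hB⟩ := g.hasCompactSupport.exists_bound_of_continuous g.continuous
    have h1 := tendsto_integral_comp_add μ (t := fun n => t (φ (ψ n)))
      (ht0.comp (hφ.tendsto_atTop.comp hψ.tendsto_atTop)) hgc
      (integrable_const B) (fun n => Eventually.of_forall fun p => hB _)
    have h2 : Tendsto (fun n => ∫ x, heat μ (t (φ (ψ n))) x * g x) atTop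
        (𝓝 (∫ x, (G x * G x) * g x)) := by
      refine tendsto_integral_of_dominated_convergence
        (fun x => (1 + R * √(|x| + 1)) ^ 2 * |g x|) (fun n => ?_) ?_ (fun n => ?_) ?_
      · exact ((measurable_heat μ _).mul g.continuous.measurable).aestronglyMeasurable
      · refine Continuous.integrable_of_hasCompactSupport (by fun_prop) ?_
        exact g.hasCompactSupport.abs.mul_left
      · refine Eventually.of_forall fun x => ?_
        rw [norm_mul, Real.norm_of_nonneg (heat_nonneg μ (ht _) x), Real.norm_eq_abs]
        gcongr
        rw [← Real.sq_sqrt (heat_nonneg μ (ht _) x)]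
        gcongr
        exact hbound _ x
      · exact Eventually.of_forall fun x => (hFlim x).mul_const _
    have h3 : ∀ n, ∫ x, heat μ (t (φ (ψ n))) x * g x = _ := fun n =>
      integral_heat_mul μ (ht _) hgc.measurable
    simp_rw [h3] at h2
    rw [tendsto_nhds_unique h1 h2, integral_withDensity_ofReal (by fun_prop)
      fun _ => mul_self_nonneg _]
  rw [fisherInfoLaw_eq hF]
  have hder : ∀ᵐ x, HasDerivAt G (W x) x := by
    filter_upwards [LocallyIntegrable.ae_hasDerivAt_integral
      ((Lp.memLp W).locallyIntegrable (by norm_num))] with x hx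
    exact (hx 0).const_add G0
  have hW2 : Integrable fun x => W x ^ 2 := (Lp.memLp W).integrable_sq
  calc ∫⁻ x, ENNReal.ofReal (deriv (fun x => G x * G x) x ^ 2 / (G x * G x))
      ≤ ∫⁻ x, ENNReal.ofReal (4 * W x ^ 2) := by
        refine lintegral_mono_ae ?_
        filter_upwards [hder] with x hx
        refine ENNReal.ofReal_le_ofReal ?_
        rw [(hx.fun_mul hx).deriv]
        -- This covers G x = 0, where the quotient is 0 by convention; elsewhere (2GW)² / G² = 4W².
        refine div_le_of_le_mul₀ (mul_self_nonneg _) (by positivity) (le_of_eq ?_)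
        ring
    _ = ENNReal.ofReal (∫ x, 4 * W x ^ 2) :=
        (ofReal_integral_eq_lintegral_ofReal (hW2.const_mul 4)
          (Eventually.of_forall fun x => by positivity)).symm
    _ ≤ ENNReal.ofReal a := by
        refine ENNReal.ofReal_le_ofReal ?_
        rw [integral_const_mul]
        have h1 : ∫ x, W x ^ 2 = ‖W‖ ^ 2 := by
          rw [← real_inner_self_eq_norm_sq, L2.inner_def]
          refine integral_congr_ae (Eventually.of_forall fun x => ?_)
          simp
        have h2 : ‖W‖ ^ 2 ≤ R ^ 2 := by gcongr
        rw [hR, Real.sq_sqrt (by positivity)] at h2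
        rw [h1]
        linarith

end

/-! ### Behaviour of the entropy under small Gaussian perturbations. -/

theorem negMulLog_le_tangent {u v : ℝ} (hu : 0 < u) (hv : 0 ≤ v) :
    Real.negMulLog v ≤ -v * Real.log u + u - v := by
  rcases hv.eq_or_lt with rfl | hv
  · simp [hu.le]
  · have h1 : Real.log u - Real.log v ≤ u / v - 1 := by
      rw [← Real.log_div hu.ne' hv.ne']
      exact Real.log_le_sub_one_of_pos (by positivity)
    have h2 : v * (Real.log u - Real.log v) ≤ u - v := by
      calc _ ≤ v * (u / v - 1) := by gcongr
        _ = u - v := by field_simp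
    simp only [Real.negMulLog]
    linarith

theorem integrable_negMulLog_of_finite {f : ℝ → ℝ} (hf : Measurable f) (h0 : ∀ x, 0 ≤ f x)
    (h : (differentialEntropyLaw (volume.withDensity fun x => ENNReal.ofReal (f x))).Finite) :
    Integrable fun x => Real.negMulLog (f x) := by
  rw [differentialEntropyLaw_withDensity hf.ennreal_ofReal] at h
  simp only [ENNReal.toReal_ofReal (h0 _)] at h
  obtain ⟨h1, h2⟩ := ne_top_of_finite_sub h
  refine ⟨(Real.continuous_negMulLog.measurable.comp hf).aestronglyMeasurable, ?_⟩
  have h3 : ∀ x, ‖Real.negMulLog (f x)‖ₑ = ENNReal.ofReal (Real.negMulLog (f x)) +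
      ENNReal.ofReal (-Real.negMulLog (f x)) := by
    intro x
    rw [← ofReal_norm, Real.norm_eq_abs]
    rcases le_total 0 (Real.negMulLog (f x)) with h | h
    · rw [abs_of_nonneg h, ENNReal.ofReal_of_nonpos (p := -Real.negMulLog (f x)) (by linarith),
        add_zero]
    · rw [abs_of_nonpos h, ENNReal.ofReal_of_nonpos (p := Real.negMulLog (f x)) h, zero_add]
  rw [hasFiniteIntegral_iff_enorm]
  simp_rw [h3]
  have hm : Measurable fun x => ENNReal.ofReal (Real.negMulLog (f x)) :=
    (Real.continuous_negMulLog.measurable.comp hf).ennreal_ofReal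
  rw [lintegral_add_left hm]
  exact ENNReal.add_lt_top.2 ⟨h1.lt_top, h2.lt_top⟩

/-- Finite Fisher information makes f' integrable, hence f ≤ B for some B, and then f log f ≤ f |log
B|. -/
theorem IsACDensity.entropy_ne_bot {μ : Measure ℝ} [IsFiniteMeasure μ] {f : ℝ → ℝ}
    (hf : IsACDensity μ f) (hI : ∫⁻ x, ENNReal.ofReal (deriv f x ^ 2 / f x) ≠ ⊤) :
    differentialEntropyLaw μ ≠ ⊥ := by
  obtain ⟨B, hB⟩ := hf.exists_bound hI
  rw [hf.eq_withDensity, differentialEntropyLaw_withDensity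
    hf.continuous.measurable.ennreal_ofReal]
  simp only [ENNReal.toReal_ofReal (hf.nonneg _)]
  have h : ∫⁻ x, ENNReal.ofReal (-Real.negMulLog (f x)) ≠ ⊤ := by
    refine ne_top_of_le_ne_top (hf.integrable.mul_const |Real.log B|).lintegral_lt_top.ne
      (lintegral_mono fun x => ENNReal.ofReal_le_ofReal ?_)
    rcases (hf.nonneg x).eq_or_lt with h | h
    · simp [← h]
    · have h1 := Real.log_le_log h (hB x)
      have h2 := le_abs_self (Real.log B)
      simp only [Real.negMulLog]
      nlinarith
  rw [Ne, sub_eq_add_neg, EReal.add_eq_bot_iff]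
  simp [h]

section

variable (μ : Measure ℝ) [IsProbabilityMeasure μ] {r : ℝ} (hr : 0 < r)
  (hμ : Integrable (fun y => Real.log (ballMass μ r y)) μ)

include hr hμ

/-- Jensen's inequality for -u log u: at each x, use the tangent at u = f_s(x) and average over y
with the kernel. -/
theorem integral_negMulLog_le_heatEntropy {f : ℝ → ℝ} (hf : Measurable f) (h0 : ∀ x, 0 ≤ f x)
    (hd : μ = volume.withDensity fun x => ENNReal.ofReal (f x))
    (hint : Integrable fun x => Real.negMulLog (f x)) {s : ℝ} (hs : 0 < s) :
    ∫ x, Real.negMulLog (f x) ≤ heatEntropy μ s := by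
  have hfi : Integrable f := by
    have := integrable_const (μ := μ) (1 : ℝ)
    rw [hd, integrable_withDensity_ofReal_iff hf h0] at this
    simpa using this
  have hheat : ∀ x, ∫ y, heatKernel s (x - y) * f y = heat μ s x := by
    intro x
    rw [heat]
    conv_rhs => rw [hd]
    rw [integral_withDensity_ofReal hf h0]
    simp [mul_comm]
  rw [← integral_heatKernel_mul hs hint]
  refine integral_mono_ae (integrable_heatKernel_mul hs hint).integral_prod_left
    (integrable_negMulLog_heat μ hr hμ hs) ?_
  filter_upwards [(integrable_heatKernel_mul hs hint).prod_right_ae,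
    (integrable_heatKernel_mul hs hfi).prod_right_ae] with x hx1 hx2
  have hk : Integrable fun y => heatKernel s (x - y) := (integrable_heatKernel hs).comp_sub_left x
  set u := heat μ s x with hu
  calc ∫ y, heatKernel s (x - y) * Real.negMulLog (f y)
      ≤ ∫ y, ((-Real.log u - 1) * (heatKernel s (x - y) * f y) + u * heatKernel s (x - y)) := by
        refine integral_mono hx1 ((hx2.const_mul _).add (hk.const_mul _)) fun y => ?_
        have := mul_le_mul_of_nonneg_left (negMulLog_le_tangent (heat_pos μ hs x) (h0 y))
          (heatKernel_pos hs (x - y)).le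
        simp only [← hu] at this ⊢
        linarith
    _ = Real.negMulLog u := by
        rw [integral_add (hx2.const_mul _) (hk.const_mul _), integral_const_mul,
          integral_const_mul, hheat, integral_sub_left_eq_self, integral_heatKernel hs, ← hu]
        simp only [Real.negMulLog]
        ring

/-- Fatou needs a nonnegative integrand, so entropy is compared with the fixed density f_1: D is the
integrand of the relative entropy to f_1, with the terms f_1 - f_t added to make it pointwise
nonnegative. The remaining cross term, the mean of log f_1 at X + √t Z, converges by domination. -/
theorem eventually_heatEntropy_le {f : ℝ → ℝ} (hf : IsACDensity μ f)
    (hI : ∫⁻ x, ENNReal.ofReal (deriv f x ^ 2 / f x) ≠ ⊤)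
    (hint : Integrable fun x => Real.negMulLog (f x)) {t : ℕ → ℝ} (ht : ∀ n, 0 < t n)
    (ht1 : ∀ n, t n ≤ 1) (ht0 : Tendsto t atTop (𝓝 0)) {ε : ℝ} (hε : 0 < ε) :
    ∀ᶠ n in atTop, heatEntropy μ (t n) ≤ (∫ x, Real.negMulLog (f x)) + ε := by
  obtain ⟨C, hC, hlog⟩ := exists_abs_log_heat_le μ (a := 1) (b := 1) (r := r) one_pos
  set l : ℝ → ℝ := fun x => Real.log (heat μ 1 x) with hl
  have hlc : Continuous l := continuous_log_heat μ one_pos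
  set Q := μ.prod (gaussianReal 0 1) with hQ
  have hmQ : ∀ᵐ p ∂Q, 0 < ballMass μ r p.1 :=
    Measure.quasiMeasurePreserving_fst.ae (ballMass_pos_ae μ hr)
  set G : ℝ × ℝ → ℝ := fun p => -Real.log (ballMass μ r p.1) + C * (1 + p.2 ^ 2) with hG
  have hGi : Integrable G Q := by
    have h1 : Integrable (fun z : ℝ => C * (1 + z ^ 2)) (gaussianReal 0 1) := by
      have h2 : Integrable (fun z : ℝ => z ^ 2) (gaussianReal 0 1) :=
        (memLp_id_gaussianReal 2).integrable_sq
      exact ((integrable_const 1).add h2).const_mul C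
    exact (hμ.neg.comp_fst _).add (h1.comp_snd _)
  have hGb : ∀ n, ∀ᵐ p ∂Q, |l (p.1 + √(t n) * p.2)| ≤ G p := by
    intro n
    filter_upwards [hmQ] with p hp
    refine (hlog 1 le_rfl le_rfl _ _ hp).trans ?_
    have h1 : (p.1 + √(t n) * p.2 - p.1) ^ 2 ≤ p.2 ^ 2 := by
      rw [add_sub_cancel_left, mul_pow, Real.sq_sqrt (ht n).le]
      exact mul_le_of_le_one_left (sq_nonneg _) (ht1 n)
    simp only [hG]
    gcongr
  have hA := tendsto_integral_comp_add μ ht0 hlc hGi hGb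
  simp_rw [← hQ, hQ, ← integral_heat_mul μ (ht _) hlc.measurable] at hA
  rw [hf.integral_eq] at hA
  have hli : ∀ n, Integrable fun x => heat μ (t n) x * l x := fun n =>
    integrable_heat_mul μ (ht n) hlc.measurable
      (hGi.mono' (hlc.comp (by fun_prop)).aestronglyMeasurable (hGb n))
  have hli0 : Integrable fun x => f x * l x := by
    rw [← hf.integrable_iff]
    refine (hμ.neg.add (integrable_const C)).mono' hlc.aestronglyMeasurable ?_
    filter_upwards [ballMass_pos_ae μ hr] with y hy
    simpa using hlog 1 le_rfl le_rfl y y hy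
  have hlim : ∀ x, Tendsto (fun n => heat μ (t n) x) atTop (𝓝 (f x)) := by
    intro x
    obtain ⟨B, hB⟩ := hf.exists_bound hI
    -- By symmetry of the kernel, f_t(x) is the mean of f at x + √t Z, that is, the case of a point
    -- mass at x.
    have h1 := tendsto_integral_comp_add (Measure.dirac x) ht0 hf.continuous (integrable_const B)
      (fun n => Eventually.of_forall fun p => by rw [abs_of_nonneg (hf.nonneg _)]; exact hB _)
    rw [integral_dirac] at h1
    refine h1.congr fun n => ?_
    rw [← integral_heat_mul _ (ht n) hf.continuous.measurable, heat, hf.integral_eq]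
    refine integral_congr_ae (Eventually.of_forall fun y => ?_)
    simp only [heat, integral_dirac]
    rw [mul_comm]
    congr 1
    unfold heatKernel
    rw [← neg_sub x y, neg_sq]
  set D : ℕ → ℝ → ℝ := fun n x =>
    -Real.negMulLog (heat μ (t n) x) - heat μ (t n) x * l x - heat μ (t n) x + heat μ 1 x with hD
  set D0 : ℝ → ℝ := fun x => -Real.negMulLog (f x) - f x * l x - f x + heat μ 1 x with hD0
  have hD0n : ∀ x, 0 ≤ D0 x := fun x => by
    have := negMulLog_le_tangent (heat_pos μ one_pos x) (hf.nonneg x)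
    simp only [hD0, hl]
    linarith
  have hDn : ∀ n x, 0 ≤ D n x := fun n x => by
    have := negMulLog_le_tangent (heat_pos μ one_pos x) (heat_nonneg μ (ht n) x)
    simp only [hD, hl]
    linarith
  have hη : ∀ n, Integrable fun x => -Real.negMulLog (heat μ (t n) x) :=
    fun n => (integrable_negMulLog_heat μ hr hμ (ht n)).neg
  have hη0 : Integrable fun x => -Real.negMulLog (f x) := hint.neg
  have hi1 : ∀ n, Integrable fun x => -Real.negMulLog (heat μ (t n) x) - heat μ (t n) x * l x :=
    fun n => (hη n).sub (hli n)
  have hi2 : ∀ n, Integrable fun x =>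
      -Real.negMulLog (heat μ (t n) x) - heat μ (t n) x * l x - heat μ (t n) x :=
    fun n => (hi1 n).sub (integrable_heat μ (ht n))
  have hDi : ∀ n, Integrable (D n) := fun n => (hi2 n).add (integrable_heat μ one_pos)
  have hi3 : Integrable fun x => -Real.negMulLog (f x) - f x * l x := hη0.sub hli0
  have hi4 : Integrable fun x => -Real.negMulLog (f x) - f x * l x - f x := hi3.sub hf.integrable
  have hD0i : Integrable D0 := hi4.add (integrable_heat μ one_pos)
  have hDint : ∀ n, ∫ x, D n x = -heatEntropy μ (t n) - ∫ x, heat μ (t n) x * l x := by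
    intro n
    simp only [hD]
    rw [integral_add (hi2 n) (integrable_heat μ one_pos), integral_sub (hi1 n)
      (integrable_heat μ (ht n)), integral_sub (hη n) (hli n), integral_neg,
      integral_heat μ one_pos, integral_heat μ (ht n), heatEntropy]
    ring
  have hD0int : ∫ x, D0 x = -(∫ x, Real.negMulLog (f x)) - ∫ x, f x * l x := by
    simp only [hD0]
    rw [integral_add hi4 (integrable_heat μ one_pos), integral_sub hi3
      hf.integrable, integral_sub hη0 hli0, integral_neg,
      integral_heat μ one_pos, hf.integral_eq_one]
    ring
  have hfatou : ENNReal.ofReal (∫ x, D0 x) ≤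
      liminf (fun n => ENNReal.ofReal (∫ x, D n x)) atTop := by
    rw [ofReal_integral_eq_lintegral_ofReal hD0i (Eventually.of_forall hD0n)]
    simp_rw [ofReal_integral_eq_lintegral_ofReal (hDi _) (Eventually.of_forall (hDn _))]
    have hDm : ∀ n, Measurable fun x => ENNReal.ofReal (D n x) := fun n =>
      ((((Real.continuous_negMulLog.measurable.comp (measurable_heat μ (t n))).neg.sub
        ((measurable_heat μ (t n)).mul hlc.measurable)).sub (measurable_heat μ (t n))).add
        (measurable_heat μ 1)).ennreal_ofReal
    refine le_trans (le_of_eq (lintegral_congr fun x => ?_)) (lintegral_liminf_le hDm)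
    refine (Tendsto.liminf_eq ?_).symm
    refine (ENNReal.continuous_ofReal.tendsto _).comp ?_
    exact ((((Real.continuous_negMulLog.tendsto _).comp (hlim x)).neg.sub
      ((hlim x).mul_const _)).sub (hlim x)).add_const _
  -- A negative left side is treated apart because `ENNReal.ofReal` loses it.
  have hDe : ∀ᶠ n in atTop, (∫ x, D0 x) - ε / 2 ≤ ∫ x, D n x := by
    rcases lt_or_ge ((∫ x, D0 x) - ε / 2) 0 with h | h
    · exact Eventually.of_forall fun n => h.le.trans (integral_nonneg (hDn n))
    · have h1 : ENNReal.ofReal ((∫ x, D0 x) - ε / 2) <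
          liminf (fun n => ENNReal.ofReal (∫ x, D n x)) atTop :=
        ((ENNReal.ofReal_lt_ofReal_iff_of_nonneg h).2 (by linarith)).trans_le hfatou
      filter_upwards [eventually_lt_of_lt_liminf h1] with n hn
      exact ((ENNReal.ofReal_lt_ofReal_iff_of_nonneg h).1 hn).le
  filter_upwards [hDe, hA.eventually (lt_mem_nhds (by linarith :
    (∫ x, f x * l x) - ε / 2 < ∫ x, f x * l x))] with n h1 h2
  rw [hDint, hD0int] at h1
  linarith

end

/-! ### The derivative of the entropy at t = 0. -/

theorem exists_isACDensity_of_fisherInfoLaw_ne_top {μ : Measure ℝ} (h : fisherInfoLaw μ ≠ ⊤) :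
    ∃ f, IsACDensity μ f ∧ ∫⁻ x, ENNReal.ofReal (deriv f x ^ 2 / f x) ≠ ⊤ := by
  by_contra! hcon
  exact h (iInf₂_eq_top.2 hcon)

section

variable (μ : Measure ℝ) [IsProbabilityMeasure μ] {r : ℝ} (hr : 0 < r)
  (hμ : Integrable (fun y => Real.log (ballMass μ r y)) μ)

include hr hμ

theorem exists_heatEntropy_slope {s t : ℝ} (hs : 0 < s) (hst : s < t) :
    ∃ c ∈ Set.Ioo s t, heatEntropy μ t - heatEntropy μ s = 2⁻¹ * heatFisher μ c * (t - s) := by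
  obtain ⟨c, hc, h⟩ := exists_hasDerivAt_eq_slope (heatEntropy μ)
    (fun u => 2⁻¹ * heatFisher μ u) hst
    (fun u hu =>
      (hasDerivAt_heatEntropy μ hr hμ (hs.trans_le hu.1)).continuousAt.continuousWithinAt)
    (fun u hu => hasDerivAt_heatEntropy μ hr hμ (hs.trans hu.1))
  refine ⟨c, hc, ?_⟩
  rw [h]
  have : t - s ≠ 0 := (sub_pos.2 hst).ne'
  field_simp

theorem eventually_mul_le_heatEntropy_sub {b H : ℝ}
    (hH : ∀ s, 0 < s → H ≤ heatEntropy μ s) (hb0 : 0 ≤ b)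
    (hb : ENNReal.ofReal (2 * b) < fisherInfoLaw μ) :
    ∀ᶠ t in 𝓝[>] 0, b * t ≤ heatEntropy μ t - H := by
  -- Otherwise J ≤ 2b along a sequence tending to 0, and lower semicontinuity would give I(X) ≤ 2b.
  have hev : ∀ᶠ t in 𝓝[>] (0 : ℝ), 2 * b < heatFisher μ t := by
    by_contra hcon
    rw [not_eventually] at hcon
    obtain ⟨t, ht0, ht⟩ := exists_seq_forall_of_frequently
      (hcon.and_eventually self_mem_nhdsWithin)
    refine hb.not_ge (fisherInfoLaw_le_of_heatFisher_le μ (fun n => (ht n).2)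
      (tendsto_nhdsWithin_iff.1 ht0).1 (by positivity) fun n => not_lt.1 (ht n).1)
  obtain ⟨δ, hδ, hev⟩ := mem_nhdsGT_iff_exists_Ioo_subset.1 hev
  filter_upwards [Ioo_mem_nhdsGT hδ] with t ht
  have h1 : ∀ s ∈ Set.Ioo 0 t, b * (t - s) ≤ heatEntropy μ t - H := by
    intro s hs
    obtain ⟨c, hc, hcs⟩ := exists_heatEntropy_slope μ hr hμ hs.1 hs.2
    have h2 : 2 * b < heatFisher μ c := hev ⟨hs.1.trans hc.1, hc.2.trans ht.2⟩
    have h3 : b * (t - s) ≤ 2⁻¹ * heatFisher μ c * (t - s) := by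
      have := hs.2
      gcongr
      linarith
    linarith [hH s hs.1]
  have h2 : Tendsto (fun s => b * (t - s)) (𝓝[>] 0) (𝓝 (b * (t - 0))) :=
    Tendsto.mono_left (Continuous.tendsto (by fun_prop) _) nhdsWithin_le_nhds
  rw [sub_zero] at h2
  exact le_of_tendsto h2 (by filter_upwards [Ioo_mem_nhdsGT ht.1] with s hs using h1 s hs)

theorem heatEntropy_sub_le {f : ℝ → ℝ} (hf : IsACDensity μ f)
    (hI : ∫⁻ x, ENNReal.ofReal (deriv f x ^ 2 / f x) ≠ ⊤)
    (hint : Integrable fun x => Real.negMulLog (f x)) {t : ℝ} (ht : 0 < t) :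
    heatEntropy μ t - ∫ x, Real.negMulLog (f x) ≤ 2⁻¹ * (∫ x, deriv f x ^ 2 / f x) * t := by
  refine le_of_forall_pos_le_add fun ε hε => ?_
  -- A sequence tending to 0, strictly below t for the mean value theorem and at most 1 as
  -- `eventually_heatEntropy_le` requires.
  set s : ℕ → ℝ := fun n => min t 1 / (n + 2) with hs
  have hm : 0 < min t 1 := lt_min ht one_pos
  have hs0 : ∀ n, 0 < s n := fun n => by positivity
  have hsm : ∀ n, s n < min t 1 := fun n => by
    refine div_lt_self hm ?_
    have : (0 : ℝ) ≤ n := n.cast_nonneg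
    linarith
  have hst : ∀ n, s n < t := fun n => (hsm n).trans_le (min_le_left _ _)
  have hlim : Tendsto s atTop (𝓝 0) :=
    tendsto_const_nhds.div_atTop (tendsto_atTop_add_const_right _ _ tendsto_natCast_atTop_atTop)
  obtain ⟨n, hn⟩ := (eventually_heatEntropy_le μ hr hμ hf hI hint hs0
    (fun n => (hsm n).le.trans (min_le_right _ _)) hlim hε).exists
  obtain ⟨c, hc, hcs⟩ := exists_heatEntropy_slope μ hr hμ (hs0 n) (hst n)
  have h1 := hf.heatFisher_le hI ((hs0 n).trans hc.1)
  have h2 : 0 ≤ ∫ x, deriv f x ^ 2 / f x :=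
    integral_nonneg fun x => div_nonneg (sq_nonneg _) (hf.nonneg x)
  have h3 : 2⁻¹ * heatFisher μ c * (t - s n) ≤ 2⁻¹ * (∫ x, deriv f x ^ 2 / f x) * t := by
    have := hst n
    have := hs0 n
    gcongr
    · linarith
  linarith

theorem tendsto_heatEntropy_slope (hlt : differentialEntropyLaw μ < ⊤) :
    Tendsto (fun t : ℝ => ((heatEntropy μ t : EReal) - differentialEntropyLaw μ) / (t : EReal))
      (𝓝[>] 0) (𝓝 ((2⁻¹ * fisherInfoLaw μ : ℝ≥0∞) : EReal)) := by
  by_cases hbot : differentialEntropyLaw μ = ⊥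
  · have hI : fisherInfoLaw μ = ⊤ := by
      by_contra hne
      obtain ⟨f, hf, hfI⟩ := exists_isACDensity_of_fisherInfoLaw_ne_top hne
      exact hf.entropy_ne_bot hfI hbot
    -- With h(X) = ⊥ the numerator is a real minus ⊥, which is ⊤, so the quotient is ⊤ for every t >
    -- 0.
    rw [hI, ENNReal.mul_top (by simp), hbot]
    refine tendsto_const_nhds.congr' ?_
    filter_upwards [self_mem_nhdsWithin] with t ht
    rw [EReal.coe_sub_bot, EReal.top_div_of_pos_ne_top (by exact_mod_cast ht) (EReal.coe_ne_top t)]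
    rfl
  have hfin : (differentialEntropyLaw μ).Finite := ⟨hbot, hlt.ne⟩
  have hac : μ ≪ volume := by
    by_contra hcon
    exact hbot (by rw [differentialEntropyLaw, if_neg hcon])
  set p : ℝ → ℝ := fun x => (μ.rnDeriv volume x).toReal with hp
  have hpm : Measurable p := (Measure.measurable_rnDeriv _ _).ennreal_toReal
  have hp0 : ∀ x, 0 ≤ p x := fun x => ENNReal.toReal_nonneg
  have hpd : μ = volume.withDensity fun x => ENNReal.ofReal (p x) := by
    conv_lhs => rw [← Measure.withDensity_rnDeriv_eq μ volume hac]
    refine withDensity_congr_ae ?_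
    filter_upwards [Measure.rnDeriv_lt_top μ volume] with x hx
    exact (ENNReal.ofReal_toReal hx.ne).symm
  have hpi : Integrable fun x => Real.negMulLog (p x) :=
    integrable_negMulLog_of_finite hpm hp0 (by rwa [← hpd])
  have hH : ∀ s, 0 < s → ∫ x, Real.negMulLog (p x) ≤ heatEntropy μ s := fun s hs =>
    integral_negMulLog_le_heatEntropy μ hr hμ hpm hp0 hpd hpi hs
  have hent : differentialEntropyLaw μ = ((∫ x, Real.negMulLog (p x) : ℝ) : EReal) := by
    conv_lhs => rw [hpd]
    exact differentialEntropyLaw_of_integrable hpm hp0 hpi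
  set H := ∫ x, Real.negMulLog (p x) with hHdef
  have hq : ∀ t : ℝ, ((heatEntropy μ t : EReal) - differentialEntropyLaw μ) / (t : EReal) =
      (((heatEntropy μ t - H) / t : ℝ) : EReal) := fun t => by
    rw [hent, EReal.coe_div, EReal.coe_sub]
  simp_rw [hq]
  refine tendsto_order.2 ⟨fun a ha => ?_, fun b hb => ?_⟩
  · rcases lt_or_ge a 0 with ha0 | ha0
    · filter_upwards [self_mem_nhdsWithin] with t ht
      refine ha0.trans_le (EReal.coe_nonneg.2 (div_nonneg (sub_nonneg.2 (hH t ht)) ?_))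
      exact (Set.mem_Ioi.1 ht).le
    · obtain ⟨b, hab, hb⟩ := EReal.lt_iff_exists_real_btwn.1 ha
      have hb0 : 0 ≤ b := by exact_mod_cast ha0.trans hab.le
      have hbI : ENNReal.ofReal (2 * b) < fisherInfoLaw μ := by
        have h1 : ENNReal.ofReal b < 2⁻¹ * fisherInfoLaw μ := by
          rw [← EReal.coe_ennreal_lt_coe_ennreal_iff, EReal.coe_ennreal_ofReal, max_eq_left hb0]
          exact hb
        rw [ENNReal.ofReal_mul (by norm_num), ENNReal.ofReal_ofNat]
        have h2 := (ENNReal.mul_lt_mul_iff_right (a := 2) (by simp) (by simp)).2 h1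
        rwa [← mul_assoc, ENNReal.mul_inv_cancel (by simp) (by simp), one_mul] at h2
      filter_upwards [eventually_mul_le_heatEntropy_sub μ hr hμ hH hb0 hbI, self_mem_nhdsWithin]
        with t ht ht0
      refine hab.trans_le (EReal.coe_le_coe_iff.2 ?_)
      rwa [le_div_iff₀ ht0]
  · have hne : fisherInfoLaw μ ≠ ⊤ := by
      intro h
      rw [h, ENNReal.mul_top (by simp)] at hb
      exact not_top_lt hb
    obtain ⟨f, hf, hfI⟩ := exists_isACDensity_of_fisherInfoLaw_ne_top hne
    have hfi : Integrable fun x => Real.negMulLog (f x) :=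
      integrable_negMulLog_of_finite hf.continuous.measurable hf.nonneg
        (by rwa [← hf.eq_withDensity])
    -- H was computed from the Radon–Nikodym density; both versions represent the entropy of the
    -- same law.
    have hfH : H = ∫ x, Real.negMulLog (f x) := by
      have h1 := differentialEntropyLaw_of_integrable hf.continuous.measurable hf.nonneg hfi
      rw [← hf.eq_withDensity, hent] at h1
      exact EReal.coe_injective h1
    have hIeq : ((2⁻¹ * fisherInfoLaw μ : ℝ≥0∞) : EReal) =
        ((2⁻¹ * ∫ x, deriv f x ^ 2 / f x : ℝ) : EReal) := by
      rw [fisherInfoLaw_eq hf, ← ofReal_integral_eq_lintegral_ofReal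
        (hf.integrable_sq_deriv_div hfI)
        (Eventually.of_forall fun x => div_nonneg (sq_nonneg _) (hf.nonneg x)),
        ← EReal.coe_ennreal_toReal (by finiteness), ENNReal.toReal_mul, ENNReal.toReal_ofReal
        (integral_nonneg fun x => div_nonneg (sq_nonneg _) (hf.nonneg x))]
      simp
    filter_upwards [self_mem_nhdsWithin] with t ht
    refine lt_of_le_of_lt ?_ hb
    rw [hIeq, EReal.coe_le_coe_iff, div_le_iff₀ ht, hfH]
    exact heatEntropy_sub_le μ hr hμ hf hfI hfi ht

end

theorem corollary2 {Ω : Type*} [MeasurableSpace Ω] (P : Measure Ω) [IsProbabilityMeasure P]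
    (X Z : Ω → ℝ) (hX : Measurable X) (hZ : Measurable Z)
    (hXZ : IndepFun X Z P) (hZlaw : P.map Z = gaussianReal 0 1)
    (hXlt : differentialEntropy X P < ⊤)
    (hXY : ∃ Y : Ω → ℝ, Measurable Y ∧ IndepFun X Y P ∧
      (differentialEntropy Y P).Finite ∧
      (differentialEntropy (fun ω => X ω + Y ω) P).Finite) :
    (∀ t : ℝ, 0 < t → (differentialEntropy (fun ω => X ω + √t * Z ω) P).Finite) ∧
    Tendsto
      (fun t : ℝ =>
        (differentialEntropy (fun ω => X ω + √t * Z ω) P - differentialEntropy X P) / (t : EReal))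
      (𝓝[>] 0)
      (𝓝 ((2⁻¹ * fisherInfo X P : ℝ≥0∞) : EReal)) := by
  obtain ⟨Y, hY, hXYi, hYfin, hXYfin⟩ := hXY
  have hμ : IsProbabilityMeasure (P.map X) := Measure.isProbabilityMeasure_map hX.aemeasurable
  have hν : IsProbabilityMeasure (P.map Y) := Measure.isProbabilityMeasure_map hY.aemeasurable
  have hYac : P.map Y ≪ volume := by
    by_contra hcon
    exact hYfin.1 (by rw [differentialEntropy, differentialEntropyLaw, if_neg hcon])
  have hconv : P.map (fun ω => X ω + Y ω) = P.map X ∗ P.map Y :=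
    hXYi.map_add_eq_map_conv_map₀ hX.aemeasurable hY.aemeasurable
  rw [differentialEntropy, hconv] at hXYfin
  obtain ⟨r, hr, hint⟩ := exists_integrable_log_ballMass (P.map X) (P.map Y) hYac hXYfin
  have hent : ∀ t : ℝ, 0 < t → differentialEntropy (fun ω => X ω + √t * Z ω) P =
      (heatEntropy (P.map X) t : EReal) := by
    intro t ht
    have h1 : P.map (fun ω => (X ω, Z ω)) = (P.map X).prod (gaussianReal 0 1) := by
      rw [← hZlaw]
      exact (indepFun_iff_map_prod_eq_prod_map_map hX.aemeasurable hZ.aemeasurable).1 hXZ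
    have h2 : P.map (fun ω => X ω + √t * Z ω) =
        volume.withDensity fun x => ENNReal.ofReal (heat (P.map X) t x) := by
      rw [← map_prod_gaussianReal (P.map X) ht, ← h1,
        Measure.map_map (by fun_prop) (hX.prodMk hZ)]
      rfl
    rw [differentialEntropy, h2]
    exact differentialEntropyLaw_of_integrable (measurable_heat _ t) (heat_nonneg _ ht)
      (integrable_negMulLog_heat _ hr hint ht)
  refine ⟨fun t ht => ?_, ?_⟩
  · rw [hent t ht]
    exact ⟨EReal.coe_ne_bot _, EReal.coe_ne_top _⟩
  · refine (tendsto_heatEntropy_slope (P.map X) hr hint hXlt).congr' ?_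
    filter_upwards [self_mem_nhdsWithin] with t ht
    rw [hent t ht]
    rfl
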